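/- Definitions. A boolean function over a finite index set $I$ is a map $f:\{0,1\}^I\to\{0,1\}$; a weight function over $I$ is a map $w:I\to\mathbb{R}_{\ge 0}$, with total weight $|w|=\sum_{i\in I} w(i)$. An assemblage $\mathcal{A}$ assigns to every finite set $I$, boolean function $f$ over $I$ and $x\in\{0,1\}^I$ a compact set $\mathcal{A}_x(f)\subseteq\mathbb{R}^I$ of weight functions over $I$. It induces the measure $m_x(f)=\min\{|w|:w\in\mathcal{A}_x(f)\}$, $m_b(f)=\max\{m_x(f):f(x)=b\}$ for $b\in\{0,1\}$, and $m(f)=\max\{m_0(f),m_1(f)\}$. Let $T$ be a finite rooted tree whose leaves all have the same depth $\ge 1$, with an ensemble of boolean functions $f_v$ over the set of children of $v$, one for every internal node $v$. Viewing $T$ as a circuit with gates $f_v$ gives a composed function $F$ over the set of leaves. An assignment $x$ to the leaves determines the assignment $b_v$ to the children of each internal node $v$. An ensemble of weight functions $w_v$ over the children of $v$ is compatible with $(f_v)$ and $x$ if $w_v\in\mathcal{A}_{b_v}(f_v)$ for every internal $v$; its composition gives each leaf the product of the weights along the path from the root. Say that $\mathcal{A}$ behaves well at $(f_v)$ and $x$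 if (1) the composition of every compatible weight ensemble lies in $\mathcal{A}_x(F)$, and (2) for every $w\in\mathcal{A}_x(F)$ there is a compatible weight ensemble whose composition has total weight at most $|w|$. The assemblage is well-behaved if this holds for all ensembles of nonconstant boolean functions and all $x$. The iterated composition of $f$ is $f^{(1)}=f$, $f^{(k)}=f\circ f^{(k-1)}$. A block of $f$ at $x$ is a set $B\subseteq I$ such that complementing the bits of $x$ in $B$ changes the value of $f$. Define: $\partial\mathcal{B}_x(f)$, the set of (indicators of) inclusion-minimal blocks; $\mathcal{W}_x(f)$, the set of (indicators of) sets meeting every block; $\mathcal{W}^*_x(f)$, the set of $w:I\to[0,1]$ with $w(B)=\sum_{i\in B}w(i)\ge 1$ for every block $B$; and $\Psi_x(f)$, whose only element is the indicator of $\{i:\{i\}\text{ is a block}\}$. The measures induced by $\mathcal{W}$, $\mathcal{W}^*$ and $\Psi$ are certificate complexity $C$, fractional certificate complexity $C^*$ and sensitivity $s$. A pair $\vec\alpha=(\alpha^0,\alpha^1)$ of assignments is $f$-compatible if $f(\alpha^0)=0$ and $f(\alpha^1)=1$. For $w^0\in\mathcal{A}_{\alpha^0}(f)$ and $w^1\in\mathcal{A}_{\alpha^1}(f)$,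 the profile matrix $M_{\vec\alpha,\vec w}$ is the $2\times 2$ matrix, indexed by $\{0,1\}$, with $(s,t)$ entry $\sum_{j:\alpha^s_j=t}w^s(j)$. Let $\rho(M)$ be the largest absolute value of an eigenvalue of $M$. Let $\hat m_{\vec\alpha}(f)$ be the minimum of $\rho(M_{\vec\alpha,\vec w})$ over all such $\vec w$, and let $\hat m(f)$ be the maximum of $\hat m_{\vec\alpha}(f)$ over all $f$-compatible $\vec\alpha$. Theorem. (a) $\partial\mathcal{B}$, $\mathcal{W}$, $\mathcal{W}^*$ and $\Psi$ are well-behaved; moreover $\mathcal{W}$, $\mathcal{W}^*$ and $\Psi$ behave well at all ensembles of boolean functions, including those with constant members. (b) Let $m$ be the measure induced by a well-behaved assemblage $\mathcal{A}$, and let $f$ be a nonconstant boolean function on $n$ variables such that $\mathcal{A}_x(f)\neq\emptyset$ for every $x$. Then the minima and the maximum in the definition of $\hat m(f)$ are attained, $$m^{\lim}(f)=\lim_{k\to\infty} m(f^{(k)})^{1/k}=\hat m(f),$$ and $m(f^{(k)})\ge \hat m(f)^k/2$ for all $k\ge 1$. If moreover $B$ is a real number such that $w(i)\le B$ for all $x$,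 all $w\in\mathcal{A}_x(f)$ and all $i$, then $m(f^{(k)})\le 2Bnk\,\hat m(f)^{k-1}$ for all $k\ge 1$. (c) In particular, for $m\in\{C,C^*,s\}$ and every nonconstant boolean function $f$ on $n$ variables, $\lim_{k\to\infty} m(f^{(k)})^{1/k}=\hat m(f)$ and $\hat m(f)^k/2\le m(f^{(k)})\le 2nk\,\hat m(f)^{k-1}$ for all $k\ge 1$. -/

import Mathlib

open Filter Topology

universe u

noncomputable section

/-- A boolean function over the index set `I`; `false` and `true` play the roles of `0` and `1`. -/
abbrev BoolFun (I : Type u) : Type u := (I → Bool) → Bool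

/-- The boolean function takes both values. -/
def BoolFun.Nonconstant {I : Type u} (f : BoolFun I) : Prop :=
  ∀ b : Bool, ∃ x, f x = b

/-- The total weight `|w|`. -/
def totalWeight {I : Type u} [Fintype I] (w : I → ℝ) : ℝ := ∑ i, w i

/-- An assemblage: to every finite index set `I`, boolean function `f` over `I` and assignment `x`
it associates a compact family of nonnegative weight functions over `I`. -/
structure Assemblage where
  family : ∀ (I : Type u) [Fintype I], BoolFun I → (I → Bool) → Set (I → ℝ)
  nonneg : ∀ (I : Type u) [Fintype I] (f : BoolFun I) (x : I → Bool),
    ∀ w ∈ family I f x, ∀ i, 0 ≤ w i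
  compact : ∀ (I : Type u) [Fintype I] (f : BoolFun I) (x : I → Bool),
    IsCompact (family I f x)

/-! ### The measure induced by an assemblage -/

namespace Assemblage

variable (A : Assemblage.{u}) {I : Type u} [Fintype I]

/-- `m_x(f)`, the minimum of `|w|` over the family at `(f, x)`. -/
def localMeasure (f : BoolFun I) (x : I → Bool) : ℝ :=
  sInf (totalWeight '' A.family I f x)

/-- `m_b(f)`, the maximum of `m_x(f)` over the assignments `x` with `f x = b`. -/
def measureOn (f : BoolFun I) (b : Bool) : ℝ :=
  sSup (A.localMeasure f '' {x | f x = b})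

/-- `m(f) = max (m_0(f), m_1(f))`. -/
def measure (f : BoolFun I) : ℝ := max (A.measureOn f false) (A.measureOn f true)

/-- The infimum in `localMeasure` is a minimum. -/
theorem isLeast_localMeasure (f : BoolFun I) (x : I → Bool) (h : (A.family I f x).Nonempty) :
    IsLeast (totalWeight '' A.family I f x) (A.localMeasure f x) := by
  have hc : Continuous (totalWeight : (I → ℝ) → ℝ) := by
    unfold totalWeight
    fun_prop
  exact ((A.compact I f x).image hc).isLeast_sInf (h.image _)

end Assemblage

/-! ### Blocks and the concrete assemblages -/

/-- `x ⊕ B`: the bits of `x` in the positions of `B` are complemented. -/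
def flipBits {I : Type u} (x : I → Bool) (B : Finset I) : I → Bool := by
  classical exact fun i => if i ∈ B then !(x i) else x i

/-- `B` is a block of `f` at `x`. -/
def IsBlock {I : Type u} (f : BoolFun I) (x : I → Bool) (B : Finset I) : Prop :=
  f (flipBits x B) ≠ f x

/-- The boolean weight function of a set of indices. -/
def setWeight {I : Type u} (S : Set I) : I → ℝ := S.indicator 1

theorem setWeight_nonneg {I : Type u} (S : Set I) (i : I) : 0 ≤ setWeight S i :=
  Set.indicator_nonneg (fun _ _ => zero_le_one) i

theorem setWeight_family_compact {I : Type u} [Fintype I] (P : Set I → Prop) :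
    IsCompact {w : I → ℝ | ∃ S, P S ∧ w = setWeight S} := by
  apply Set.Finite.isCompact
  apply (Set.finite_range (setWeight : Set I → I → ℝ)).subset
  rintro w ⟨S, -, rfl⟩
  exact ⟨S, rfl⟩

/-- The minblock assemblage `∂B`: blocks that are minimal under containment. -/
def minBlockAssemblage : Assemblage.{u} where
  family I _ f x := {w | ∃ S : Set I, (∃ B : Finset I, Minimal (IsBlock f x) B ∧ S = ↑B) ∧
    w = setWeight S}
  nonneg := by
    rintro I _ f x w ⟨S, -, rfl⟩ i
    exact setWeight_nonneg S i
  compact _ _ _ _ := setWeight_family_compact _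

/-- The witness assemblage `W`: the sets of indices that meet every block. -/
def witnessAssemblage : Assemblage.{u} where
  family I _ f x := {w | ∃ S : Set I, (∀ B : Finset I, IsBlock f x B → ∃ i ∈ B, i ∈ S) ∧
    w = setWeight S}
  nonneg := by
    rintro I _ f x w ⟨S, -, rfl⟩ i
    exact setWeight_nonneg S i
  compact _ _ _ _ := setWeight_family_compact _

/-- The fractional witness assemblage `W*`: the `[0,1]`-valued weight functions that give every
block weight at least `1`. -/
def fractionalWitnessAssemblage : Assemblage.{u} where
  family I _ f x := {w | (∀ i, 0 ≤ w i ∧ w i ≤ 1) ∧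
    ∀ B : Finset I, IsBlock f x B → 1 ≤ ∑ i ∈ B, w i}
  nonneg _ _ _ _ _ hw i := (hw.1 i).1
  compact I _ f x := by
    have hK : IsCompact (Set.Icc (0 : I → ℝ) 1) := isCompact_Icc
    refine hK.of_isClosed_subset ?_ (fun w hw => ⟨fun i => (hw.1 i).1, fun i => (hw.1 i).2⟩)
    have h1 : IsClosed {w : I → ℝ | ∀ i, 0 ≤ w i ∧ w i ≤ 1} := by
      simp only [Set.ofPred_forall, Set.ofPred_and]
      exact isClosed_iInter fun i =>
        (isClosed_le continuous_const (continuous_apply i)).inter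
          (isClosed_le (continuous_apply i) continuous_const)
    have h2 : IsClosed {w : I → ℝ | ∀ B : Finset I, IsBlock f x B → 1 ≤ ∑ i ∈ B, w i} := by
      simp only [Set.ofPred_forall]
      exact isClosed_iInter fun B => isClosed_iInter fun _ =>
        isClosed_le continuous_const (by fun_prop)
    exact h1.inter h2

/-- The sensitivity assemblage `Ψ`: the single weight function that marks the sensitive indices. -/
def sensitivityAssemblage : Assemblage.{u} where
  family _ _ f x := {setWeight {i | IsBlock f x {i}}}
  nonneg := by
    rintro I _ f x w rfl i
    exact setWeight_nonneg _ i
  compact _ _ _ _ := isCompact_singleton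

/-- The local measure induced by `Ψ` is the number of sensitive indices. -/
theorem localMeasure_sensitivityAssemblage {I : Type u} [Fintype I] (f : BoolFun I)
    (x : I → Bool) :
    sensitivityAssemblage.localMeasure f x = ({i | IsBlock f x {i}} : Set I).ncard := by
  classical
  simp [Assemblage.localMeasure, sensitivityAssemblage, totalWeight, setWeight,
    Set.indicator_apply, Set.ncard_eq_toFinset_card']

/-! ### Indexed trees, ensembles and compositions -/

/-- Finite indexed trees all of whose leaves are at the same distance `d ≥ 1` from the root. The
edges from an internal node to its children are labelled bijectively by a finite type. -/
inductive IndexedTree : ℕ → Type (u + 1)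
  | star (I : Type u) [inst : Fintype I] : IndexedTree 1
  | node {d : ℕ} (I : Type u) [inst : Fintype I] (child : I → IndexedTree d) : IndexedTree (d + 1)

namespace IndexedTree

/-- The leaves `L(T)`, as sequences of edge labels. -/
def Leaves : {d : ℕ} → IndexedTree.{u} d → Type u
  | _, star I => I
  | _, node I child => Σ i : I, (child i).Leaves

/-- The set of leaves is finite. -/
@[reducible]
def leavesFintype : {d : ℕ} → (T : IndexedTree.{u} d) → Fintype T.Leaves
  | _, star _ (inst := inst) => inst
  | _, node I (inst := inst) child =>
      letI := inst
      letI := fun i => (child i).leavesFintype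
      (inferInstance : Fintype (Σ i : I, (child i).Leaves))

instance {d : ℕ} (T : IndexedTree.{u} d) : Fintype T.Leaves := T.leavesFintype

/-- A `T`-ensemble of objects of type `X`: an object over the set `I(v)` of edge labels for every
internal node `v` of `T`. -/
def Ensemble (X : Type u → Type u) : {d : ℕ} → IndexedTree.{u} d → Type u
  | _, star I => X I
  | _, node I child => X I × ∀ i : I, Ensemble X (child i)

/-- The composition of an ensemble of boolean functions: the tree is evaluated as a circuit. -/
def composeFun : {d : ℕ} → (T : IndexedTree.{u} d) → T.Ensemble BoolFun → BoolFun T.Leaves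
  | _, star _, f => f
  | _, node _ child, f => fun x => f.1 fun i => (child i).composeFun (f.2 i) fun l => x ⟨i, l⟩

/-- The composition of an ensemble of weight functions: the weight of a leaf is the product of the
weights along the path from the root. -/
def composeWeight : {d : ℕ} → (T : IndexedTree.{u} d) → T.Ensemble (fun I => I → ℝ) →
    T.Leaves → ℝ
  | _, star _, w => w
  | _, node _ child, w => fun l => w.1 l.1 * (child l.1).composeWeight (w.2 l.1) l.2

/-- Every gate of the ensemble is nonconstant. -/
def NonconstantGates : {d : ℕ} → (T : IndexedTree.{u} d) → T.Ensemble BoolFun → Prop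
  | _, star _, f => BoolFun.Nonconstant f
  | _, node _ child, f => BoolFun.Nonconstant f.1 ∧ ∀ i, (child i).NonconstantGates (f.2 i)

/-- The weight function ensemble `w` is compatible with the ensemble `f` of boolean functions and
the leaf assignment `x`: at each internal node `v` the weight function lies in the family of the
assemblage at `(f_v, b_v)`, where `b_v` is the assignment to the children of `v` that is obtained by
evaluating the circuit on `x`. -/
def CompatibleWeights (A : Assemblage.{u}) : {d : ℕ} → (T : IndexedTree.{u} d) →
    T.Ensemble BoolFun → (T.Leaves → Bool) → T.Ensemble (fun I => I → ℝ) → Prop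
  | _, star I, f, x, w => w ∈ A.family I f x
  | _, node I child, f, x, w =>
      w.1 ∈ A.family I f.1 (fun i => (child i).composeFun (f.2 i) fun l => x ⟨i, l⟩) ∧
        ∀ i, (child i).CompatibleWeights A (f.2 i) (fun l => x ⟨i, l⟩) (w.2 i)

/-- `power I k` is the `(k+1)`-wise iterated composition of the star with index set `I`. -/
def power (I : Type u) [Fintype I] : (k : ℕ) → IndexedTree.{u} (k + 1)
  | 0 => star I
  | k + 1 => node I fun _ => power I k

/-- The ensemble that places the same boolean function at every internal node. -/
def constEnsemble {I : Type u} [Fintype I] (f : BoolFun I) :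
    (k : ℕ) → (power I k).Ensemble BoolFun
  | 0 => f
  | k + 1 => (f, fun _ => constEnsemble f k)

end IndexedTree

/-- `iterComp f k` is the iterated composition `f^{(k+1)}`, so that `iterComp f 0 = f` and
`iterComp f (k+1) = f ∘ iterComp f k`. -/
def iterComp {I : Type u} [Fintype I] (f : BoolFun I) (k : ℕ) :
    BoolFun (IndexedTree.power I k).Leaves :=
  (IndexedTree.power I k).composeFun (IndexedTree.constEnsemble f k)

namespace Assemblage

/-- The two properties that define good behaviour, for one ensemble `f` and one leaf assignment `x`:
compositions of compatible weight ensembles belong to the family of the composed function, and every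
member of that family is at least as heavy as some such composition. -/
def BehavesWellAt (A : Assemblage.{u}) {d : ℕ} (T : IndexedTree.{u} d)
    (f : T.Ensemble BoolFun) (x : T.Leaves → Bool) : Prop :=
  (∀ w, T.CompatibleWeights A f x w →
    T.composeWeight w ∈ A.family T.Leaves (T.composeFun f) x) ∧
  ∀ w ∈ A.family T.Leaves (T.composeFun f) x, ∃ w', T.CompatibleWeights A f x w' ∧
    totalWeight (T.composeWeight w') ≤ totalWeight w

/-- The assemblage is well behaved: the two properties hold for all ensembles of nonconstant boolean
functions. -/
def IsWellBehaved (A : Assemblage.{u}) : Prop :=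
  ∀ (d : ℕ) (T : IndexedTree.{u} d) (f : T.Ensemble BoolFun), T.NonconstantGates f →
    ∀ x, A.BehavesWellAt T f x

end Assemblage

/-! ### Profile matrices and the characteristic value -/

/-- The assignment selector `α = (α⁰, α¹)` is `f`-compatible: `f(α⁰) = 0` and `f(α¹) = 1`. -/
def IsCompatible {I : Type u} (f : BoolFun I) (α : Bool → I → Bool) : Prop :=
  ∀ b, f (α b) = b

/-- The profile matrix: the `(s, t)` entry is the sum of `w^s(j)` over the `j` with `α^s_j = t`. -/
def profileMatrix {I : Type u} [Fintype I] (α : Bool → I → Bool) (w : Bool → I → ℝ) :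
    Matrix Bool Bool ℝ :=
  Matrix.of fun s t => ∑ j with α s j = t, w s j

/-- `ρ(M)`, the largest absolute value of a complex eigenvalue of the real matrix `M`. -/
def rho (M : Matrix Bool Bool ℝ) : ℝ :=
  (spectralRadius ℂ (M.map (algebraMap ℝ ℂ))).toReal

namespace Assemblage

variable (A : Assemblage.{u}) {I : Type u} [Fintype I]

/-- The set of profile matrices of `f` at the assignment selector `α`. -/
def profileFamily (f : BoolFun I) (α : Bool → I → Bool) : Set (Matrix Bool Bool ℝ) :=
  {M | ∃ w : Bool → I → ℝ, (∀ b, w b ∈ A.family I f (α b)) ∧ M = profileMatrix α w}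

/-- The minimum of `ρ` over the profile matrices of `f` at `α`. -/
def charValueAt (f : BoolFun I) (α : Bool → I → Bool) : ℝ :=
  sInf (rho '' A.profileFamily f α)

/-- The characteristic value: the maximum of `charValueAt` over the `f`-compatible selectors. -/
def charValue (f : BoolFun I) : ℝ :=
  sSup (A.charValueAt f '' {α | IsCompatible f α})

end Assemblage

end

noncomputable section

/-! ### Two-level compositions -/

/-! Good behaviour reduces to two levels: induction on the tree turns a statement about one outer
gate and arbitrary inner functions into the statement about all trees. For two levels everything
rests on `isBlock_sigmaComp`: a set is a block of the composition exactly when the set of inner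
functions that it flips is a block of the outer gate.

For a well-behaved assemblage, the local measure of `f ∘ f^(k)` is the minimum over `w` of `∑ w i *
m_i`, where `m_i` is the local measure of the `i`-th copy of `f^(k)`. Hence the pair `(m_0, m_1)`
evolves under a max-min of profile matrices, and its growth rate is governed by their Perron
eigenvalues.

Lower bound (`exists_expanding_vector`): for a maximizing selector, a connectedness argument yields
one nonnegative vector, of coordinate sum 1, that every choice of weights expands by at least the
characteristic value. It is carried along the iteration, and adding its two coordinates costs the
factor 1/2.

Upper bound (`exists_contracting_vector`): for each `L` above the characteristic value, a min-max
over pairs of inputs yields one positive vector such that at every input some weight function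
multiplies it by at most `L`. The ratio of its coordinates may degenerate as `L` decreases to the
characteristic value, so the iteration also tracks the constant vector; the resulting triangular
recursion has a bound uniform in `L` (`measure_iterComp_le_of_lt`), at the price of a factor linear
in `k`. Letting `L` decrease gives the explicit bound, and `k`-th roots give the limit. -/

/-- The two-level composition of `f` with the functions `g i`. -/
def sigmaComp {I : Type u} {J : I → Type u} (f : BoolFun I) (g : ∀ i, BoolFun (J i)) :
    BoolFun (Σ i, J i) :=
  fun x => f fun i => g i fun l => x ⟨i, l⟩

/-- Good behaviour for a two-level composition. -/
def Assemblage.ComposesAt (A : Assemblage.{u}) {I : Type u} [Fintype I] {J : I → Type u}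
    [∀ i, Fintype (J i)] (f : BoolFun I) (g : ∀ i, BoolFun (J i)) (x : (Σ i, J i) → Bool) : Prop :=
  (∀ w ∈ A.family I f (fun i => g i fun l => x ⟨i, l⟩), ∀ v : ∀ i, J i → ℝ,
    (∀ i, v i ∈ A.family (J i) (g i) fun l => x ⟨i, l⟩) →
      (fun l : Σ i, J i => w l.1 * v l.1 l.2) ∈ A.family (Σ i, J i) (sigmaComp f g) x) ∧
  ∀ W ∈ A.family (Σ i, J i) (sigmaComp f g) x,
    ∃ w ∈ A.family I f (fun i => g i fun l => x ⟨i, l⟩), ∃ v : ∀ i, J i → ℝ,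
      (∀ i, v i ∈ A.family (J i) (g i) fun l => x ⟨i, l⟩) ∧
        ∑ i, w i * totalWeight (v i) ≤ totalWeight W

theorem totalWeight_composeWeight_node {d : ℕ} (I : Type u) [Fintype I]
    (child : I → IndexedTree.{u} d)
    (w : (IndexedTree.node I child).Ensemble (fun I => I → ℝ)) :
    totalWeight ((IndexedTree.node I child).composeWeight w) =
      ∑ i, w.1 i * totalWeight ((child i).composeWeight (w.2 i)) := by
  simp only [totalWeight, Finset.mul_sum]
  exact Fintype.sum_sigma (fun l : Σ i, (child i).Leaves =>
    w.1 l.1 * (child l.1).composeWeight (w.2 l.1) l.2)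

/-- The two-level property only supplies inner weights from the families of the composed children.
Good behaviour of each child replaces them by compositions that are no heavier, and nonnegative
outer weights preserve the inequality. -/
theorem Assemblage.ComposesAt.behavesWellAt_node {A : Assemblage.{u}} {d : ℕ} {I : Type u}
    [Fintype I] {child : I → IndexedTree.{u} d}
    {f : (IndexedTree.node I child).Ensemble BoolFun}
    {x : (IndexedTree.node I child).Leaves → Bool}
    (h : A.ComposesAt f.1 (fun i => (child i).composeFun (f.2 i)) x)
    (hc : ∀ i, A.BehavesWellAt (child i) (f.2 i) fun l => x ⟨i, l⟩) :
    A.BehavesWellAt (IndexedTree.node I child) f x := by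
  refine ⟨fun w hw => ?_, fun W hW => ?_⟩
  · exact h.1 w.1 hw.1 (fun i => (child i).composeWeight (w.2 i))
      fun i => (hc i).1 _ (hw.2 i)
  · obtain ⟨w, hw, v, hv, hle⟩ := h.2 W hW
    choose v' hv' hle' using fun i => (hc i).2 _ (hv i)
    refine ⟨(w, v'), ⟨hw, hv'⟩, le_trans ?_ hle⟩
    refine (totalWeight_composeWeight_node I child _).trans_le ?_
    exact Finset.sum_le_sum fun i _ =>
      mul_le_mul_of_nonneg_left (hle' i) (A.nonneg _ _ _ _ hw i)

theorem Assemblage.behavesWellAt_star (A : Assemblage.{u}) (I : Type u) [Fintype I]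
    (f : (IndexedTree.star I).Ensemble BoolFun) (x : (IndexedTree.star I).Leaves → Bool) :
    A.BehavesWellAt (IndexedTree.star I) f x :=
  ⟨fun _ hw => hw, fun w hw => ⟨w, hw, le_rfl⟩⟩

theorem Assemblage.behavesWellAt_of_composesAt {A : Assemblage.{u}}
    (h : ∀ (I : Type u) [Fintype I] (J : I → Type u) [∀ i, Fintype (J i)] (f : BoolFun I)
      (g : ∀ i, BoolFun (J i)) (x : (Σ i, J i) → Bool), A.ComposesAt f g x)
    {d : ℕ} (T : IndexedTree.{u} d) (f : T.Ensemble BoolFun) (x : T.Leaves → Bool) :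
    A.BehavesWellAt T f x := by
  induction T with
  | star I => exact A.behavesWellAt_star I f x
  | node I child ih =>
    exact (h I _ f.1 _ x).behavesWellAt_node fun i => ih i _ _

theorem IndexedTree.NonconstantGates.nonconstant_composeFun {d : ℕ} {T : IndexedTree.{u} d}
    {f : T.Ensemble BoolFun} (hf : T.NonconstantGates f) : (T.composeFun f).Nonconstant := by
  induction T with
  | star I => exact hf
  | node I child ih =>
    intro b
    obtain ⟨a, ha⟩ := hf.1 b
    choose y hy using fun i => ih i (hf.2 i) (a i)
    refine ⟨fun l : Σ i, (child i).Leaves => y l.1 l.2, ?_⟩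
    simpa only [IndexedTree.composeFun, hy] using ha

/-- Nonconstancy is only asked of the inner functions; it is available at every node because a
composition of nonconstant gates is nonconstant. -/
theorem Assemblage.isWellBehaved_of_composesAt {A : Assemblage.{u}}
    (h : ∀ (I : Type u) [Fintype I] (J : I → Type u) [∀ i, Fintype (J i)] (f : BoolFun I)
      (g : ∀ i, BoolFun (J i)) (x : (Σ i, J i) → Bool), (∀ i, (g i).Nonconstant) →
        A.ComposesAt f g x) : A.IsWellBehaved := by
  intro d T f hf x
  induction T with
  | star I => exact A.behavesWellAt_star I f x
  | node I child ih =>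
    exact (h I _ f.1 _ x fun i => (hf.2 i).nonconstant_composeFun).behavesWellAt_node
      fun i => ih i _ (hf.2 i) _

/-! ### Blocks of two-level compositions -/

theorem flipBits_apply {I : Type u} [DecidableEq I] (x : I → Bool) (B : Finset I) (i : I) :
    flipBits x B i = if i ∈ B then !(x i) else x i := by
  unfold flipBits
  congr

@[simp]
theorem flipBits_empty {I : Type u} (x : I → Bool) : flipBits x ∅ = x := by
  classical
  funext i
  simp [flipBits_apply]

@[simp]
theorem not_isBlock_empty {I : Type u} (f : BoolFun I) (x : I → Bool) : ¬ IsBlock f x ∅ := by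
  simp [IsBlock]

theorem IsBlock.nonempty {I : Type u} {f : BoolFun I} {x : I → Bool} {B : Finset I}
    (hB : IsBlock f x B) : B.Nonempty := by
  rw [Finset.nonempty_iff_ne_empty]
  rintro rfl
  exact not_isBlock_empty _ _ hB

theorem BoolFun.Nonconstant.exists_isBlock {I : Type u} [Fintype I] {f : BoolFun I}
    (hf : f.Nonconstant) (x : I → Bool) : ∃ B, IsBlock f x B := by
  classical
  obtain ⟨y, hy⟩ := hf (!(f x))
  refine ⟨Finset.univ.filter fun i => y i ≠ x i, ?_⟩
  have : flipBits x (Finset.univ.filter fun i => y i ≠ x i) = y := by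
    funext i
    simp only [flipBits_apply, Finset.mem_filter, Finset.mem_univ, true_and]
    cases y i <;> cases x i <;> simp
  simp [IsBlock, this, hy]

theorem exists_minimal_isBlock_subset {I : Type u} {f : BoolFun I} {x : I → Bool} {B : Finset I}
    (hB : IsBlock f x B) : ∃ S ⊆ B, Minimal (IsBlock f x) S := by
  obtain ⟨S, hS, hm⟩ := exists_minimal_le_of_wellFoundedLT (IsBlock f x) B hB
  exact ⟨S, hS, hm⟩

section Sigma

variable {I : Type u} {J : I → Type u}

/-- The part of `B` that lies over `i`. -/
def slice (B : Finset (Σ i, J i)) (i : I) : Finset (J i) :=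
  B.preimage (Sigma.mk i) (sigma_mk_injective.injOn)

@[simp]
theorem mem_slice {B : Finset (Σ i, J i)} {i : I} {l : J i} : l ∈ slice B i ↔ ⟨i, l⟩ ∈ B := by
  simp [slice]

theorem slice_sigma_of_mem {R : Finset I} {S : ∀ i, Finset (J i)} {i : I} (hi : i ∈ R) :
    slice (R.sigma S) i = S i := by
  ext l
  simp [hi]

theorem slice_sigma_of_notMem {R : Finset I} {S : ∀ i, Finset (J i)} {i : I} (hi : i ∉ R) :
    slice (R.sigma S) i = ∅ := by
  ext l
  simp [hi]

theorem slice_singleton_self (i : I) (l : J i) : slice {⟨i, l⟩} i = {l} := by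
  ext l'
  simp

theorem slice_singleton_of_ne {i i' : I} (l : J i) (h : i' ≠ i) : slice {⟨i, l⟩} i' = ∅ := by
  ext l'
  simp [h]

theorem slice_mono {B C : Finset (Σ i, J i)} (h : B ⊆ C) (i : I) : slice B i ⊆ slice C i :=
  fun _ hl => mem_slice.2 (h (mem_slice.1 hl))

theorem sum_eq_sum_slice [Fintype I] (B : Finset (Σ i, J i)) (h : (Σ i, J i) → ℝ) :
    ∑ p ∈ B, h p = ∑ i, ∑ l ∈ slice B i, h ⟨i, l⟩ := by
  rw [← Finset.sum_sigma (Finset.univ) (slice B) h]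
  congr 1
  ext ⟨i, l⟩
  simp

variable [Fintype I]

open Classical in
/-- The indices whose inner function changes its value when the bits in `B` are complemented. -/
def flippedIndices (g : ∀ i, BoolFun (J i)) (x : (Σ i, J i) → Bool) (B : Finset (Σ i, J i)) :
    Finset I :=
  Finset.univ.filter fun i => IsBlock (g i) (fun l => x ⟨i, l⟩) (slice B i)

@[simp]
theorem mem_flippedIndices {g : ∀ i, BoolFun (J i)} {x : (Σ i, J i) → Bool}
    {B : Finset (Σ i, J i)} {i : I} :
    i ∈ flippedIndices g x B ↔ IsBlock (g i) (fun l => x ⟨i, l⟩) (slice B i) := by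
  simp [flippedIndices]

/-- Complementing the bits in `B` changes the input of `f` exactly at the flipped indices. -/
theorem isBlock_sigmaComp (f : BoolFun I) (g : ∀ i, BoolFun (J i)) (x : (Σ i, J i) → Bool)
    (B : Finset (Σ i, J i)) :
    IsBlock (sigmaComp f g) x B ↔
      IsBlock f (fun i => g i fun l => x ⟨i, l⟩) (flippedIndices g x B) := by
  classical
  have key : (fun i => g i fun l => flipBits x B ⟨i, l⟩) =
      flipBits (fun i => g i fun l => x ⟨i, l⟩) (flippedIndices g x B) := by
    funext i
    have h1 : (fun l => flipBits x B ⟨i, l⟩) = flipBits (fun l => x ⟨i, l⟩) (slice B i) := by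
      funext l
      simp [flipBits_apply]
    rw [h1, flipBits_apply]
    split_ifs with h <;> rw [mem_flippedIndices, IsBlock] at h
    · revert h
      cases g i (flipBits (fun l => x ⟨i, l⟩) (slice B i)) <;>
        cases (g i fun l => x ⟨i, l⟩) <;> simp
    · exact not_not.1 h
  unfold IsBlock sigmaComp
  rw [key]

theorem flippedIndices_sigma {g : ∀ i, BoolFun (J i)} {x : (Σ i, J i) → Bool} {R : Finset I}
    {S : ∀ i, Finset (J i)} (hS : ∀ i ∈ R, IsBlock (g i) (fun l => x ⟨i, l⟩) (S i)) :
    flippedIndices g x (R.sigma S) = R := by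
  ext i
  by_cases hi : i ∈ R
  · simp [slice_sigma_of_mem hi, hi, hS i hi]
  · simp [slice_sigma_of_notMem hi, hi]

theorem isBlock_sigmaComp_sigma {f : BoolFun I} {g : ∀ i, BoolFun (J i)}
    {x : (Σ i, J i) → Bool} {R : Finset I} {S : ∀ i, Finset (J i)}
    (hR : IsBlock f (fun i => g i fun l => x ⟨i, l⟩) R)
    (hS : ∀ i ∈ R, IsBlock (g i) (fun l => x ⟨i, l⟩) (S i)) :
    IsBlock (sigmaComp f g) x (R.sigma S) := by
  rw [isBlock_sigmaComp, flippedIndices_sigma hS]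
  exact hR

end Sigma

/-! ### The concrete assemblages -/

theorem setWeight_apply {I : Type u} (S : Set I) [DecidablePred (· ∈ S)] (i : I) :
    setWeight S i = if i ∈ S then 1 else 0 := by
  simp [setWeight, Set.indicator_apply]

theorem setWeight_sigma {I : Type u} {J : I → Type u} (R : Set I) (S : ∀ i, Set (J i)) :
    (fun l : Σ i, J i => setWeight R l.1 * setWeight (S l.1) l.2) =
      setWeight {l | l.1 ∈ R ∧ l.2 ∈ S l.1} := by
  classical
  funext l
  by_cases h1 : l.1 ∈ R <;> by_cases h2 : l.2 ∈ S l.1 <;> simp [setWeight_apply, h1, h2]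

theorem totalWeight_nonneg {I : Type u} [Fintype I] {w : I → ℝ} (hw : ∀ i, 0 ≤ w i) :
    0 ≤ totalWeight w :=
  Finset.sum_nonneg fun i _ => hw i

theorem totalWeight_sigma {I : Type u} [Fintype I] {J : I → Type u} [∀ i, Fintype (J i)]
    (W : (Σ i, J i) → ℝ) : totalWeight W = ∑ i, totalWeight fun l => W ⟨i, l⟩ :=
  Fintype.sum_sigma _

theorem setWeight_mul_le {I : Type u} {R : Set I} {i : I} {a b : ℝ} (h : i ∈ R → a ≤ b)
    (hb : 0 ≤ b) : setWeight R i * a ≤ b := by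
  classical
  rw [setWeight_apply]
  split_ifs with hi
  · simpa using h hi
  · simpa using hb

/-- A block inside `R.sigma S` flips only indices in `R`, hence all of them by minimality of `R`;
its slices are then blocks inside the minimal `S i`, hence equal to them. Conversely, minimal blocks
are chosen inside the flipped set and inside the slices. -/
theorem minBlockAssemblage_composesAt {I : Type u} [Fintype I] {J : I → Type u}
    [∀ i, Fintype (J i)] (f : BoolFun I) (g : ∀ i, BoolFun (J i)) (x : (Σ i, J i) → Bool)
    (hg : ∀ i, (g i).Nonconstant) : minBlockAssemblage.ComposesAt f g x := by
  classical
  constructor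
  · rintro w ⟨_, ⟨R, hR, rfl⟩, rfl⟩ v hv
    choose _ hS' hv' using hv
    choose S hS hS'' using hS'
    refine ⟨_, ⟨R.sigma S, ⟨isBlock_sigmaComp_sigma hR.prop fun i _ => (hS i).prop, ?_⟩, rfl⟩, ?_⟩
    · intro B hB hle
      rw [isBlock_sigmaComp] at hB
      have hsub : flippedIndices g x B ⊆ R := by
        intro i hi
        rw [mem_flippedIndices] at hi
        obtain ⟨l, hl⟩ : (slice B i).Nonempty := hi.nonempty
        exact (Finset.mem_sigma.1 (hle (mem_slice.1 hl))).1
      have hall := hR.le_of_le hB hsub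
      rintro ⟨i, l⟩ hl
      rw [Finset.mem_sigma] at hl
      have h1 := mem_flippedIndices.1 (hall hl.1)
      have h2 : slice B i ⊆ S i := by
        rw [← slice_sigma_of_mem (S := S) hl.1]
        exact slice_mono hle i
      exact mem_slice.1 ((hS i).le_of_le h1 h2 hl.2)
    · have : v = fun i => setWeight (S i : Set (J i)) := by
        funext i
        rw [hv', hS'']
      rw [this, setWeight_sigma (↑R) fun i => (S i : Set (J i))]
      congr 1
      ext l
      simp
  · rintro W ⟨_, ⟨B, hB, rfl⟩, rfl⟩
    have hb := (isBlock_sigmaComp f g x B).1 hB.prop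
    have key : ∀ i, ∃ S, Minimal (IsBlock (g i) fun l => x ⟨i, l⟩) S ∧
        (i ∈ flippedIndices g x B → S ⊆ slice B i) := by
      intro i
      by_cases hi : i ∈ flippedIndices g x B
      · obtain ⟨S, hS, hm⟩ := exists_minimal_isBlock_subset (mem_flippedIndices.1 hi)
        exact ⟨S, hm, fun _ => hS⟩
      -- An unflipped child has outer weight 0 but still needs a member of its family; this is where
      -- nonconstancy of `g i` enters.
      · obtain ⟨C, hC⟩ := (hg i).exists_isBlock fun l => x ⟨i, l⟩
        obtain ⟨S, -, hm⟩ := exists_minimal_isBlock_subset hC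
        exact ⟨S, hm, fun h => absurd h hi⟩
    choose S hS hSB using key
    obtain ⟨R, hRB, hR⟩ := exists_minimal_isBlock_subset hb
    refine ⟨_, ⟨R, ⟨R, hR, rfl⟩, rfl⟩, fun i => setWeight (S i), fun i => ⟨_, ⟨S i, hS i, rfl⟩, rfl⟩,
      ?_⟩
    rw [totalWeight_sigma]
    refine Finset.sum_le_sum fun i _ => setWeight_mul_le (fun hi => ?_)
      (totalWeight_nonneg fun l => setWeight_nonneg _ _)
    refine Finset.sum_le_sum fun l _ => ?_
    simp only [setWeight_apply]
    by_cases hl : l ∈ S i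
    · have := mem_slice.1 (hSB i (hRB hi) hl)
      simp [hl, this]
    · simp only [Finset.mem_coe, hl, if_false]
      split_ifs <;> norm_num

/-- If the indices where the slice of `S` is an inner witness missed an outer block, then inner
blocks avoiding `S` over that outer block would assemble into a block of the composition avoiding
`S`. -/
theorem witnessAssemblage_composesAt {I : Type u} [Fintype I] {J : I → Type u}
    [∀ i, Fintype (J i)] (f : BoolFun I) (g : ∀ i, BoolFun (J i)) (x : (Σ i, J i) → Bool) :
    witnessAssemblage.ComposesAt f g x := by
  classical
  constructor
  · rintro w ⟨R, hR, rfl⟩ v hv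
    choose S hS hv' using hv
    refine ⟨{l | l.1 ∈ R ∧ l.2 ∈ S l.1}, fun B hB => ?_, ?_⟩
    · obtain ⟨i, hi, hiR⟩ := hR _ ((isBlock_sigmaComp f g x B).1 hB)
      obtain ⟨l, hl, hlS⟩ := hS i _ (mem_flippedIndices.1 hi)
      exact ⟨⟨i, l⟩, mem_slice.1 hl, hiR, hlS⟩
    · simp only [hv']
      exact setWeight_sigma R S
  · rintro W ⟨S, hS, rfl⟩
    let R : Set I :=
      {i | ∀ B, IsBlock (g i) (fun l => x ⟨i, l⟩) B → ∃ l ∈ B, (⟨i, l⟩ : Σ i, J i) ∈ S}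
    refine ⟨_, ⟨R, fun B hB => ?_, rfl⟩,
      fun i => setWeight (if i ∈ R then {l | (⟨i, l⟩ : Σ i, J i) ∈ S} else Set.univ),
      fun i => ⟨_, fun B hB => ?_, rfl⟩, ?_⟩
    · by_contra! hcon
      have : ∀ i, ∃ C : Finset (J i), i ∈ B →
          IsBlock (g i) (fun l => x ⟨i, l⟩) C ∧ ∀ l ∈ C, (⟨i, l⟩ : Σ i, J i) ∉ S := by
        intro i
        by_cases hi : i ∈ B
        · have h := hcon i hi
          simp only [R, Set.mem_ofPred_eq] at h
          push Not at h
          obtain ⟨C, hC, hC'⟩ := h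
          exact ⟨C, fun _ => ⟨hC, hC'⟩⟩
        · exact ⟨∅, fun h => absurd h hi⟩
      choose C hC using this
      obtain ⟨⟨i, l⟩, hl, hlS⟩ := hS _ (isBlock_sigmaComp_sigma hB fun i hi => (hC i hi).1)
      rw [Finset.mem_sigma] at hl
      exact (hC i hl.1).2 l hl.2 hlS
    · split_ifs with hi
      · exact hi B hB
      · obtain ⟨l, hl⟩ := hB.nonempty
        exact ⟨l, hl, trivial⟩
    · rw [totalWeight_sigma]
      refine Finset.sum_le_sum fun i _ => setWeight_mul_le (fun hi => ?_)
        (totalWeight_nonneg fun l => setWeight_nonneg _ _)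
      refine Finset.sum_le_sum fun l _ => le_of_eq ?_
      simp [setWeight_apply, hi]

/-- A single leaf flips at most its own child, so sensitivity is the product of inner and outer
sensitivity and both conditions hold with equality. -/
theorem sensitivityAssemblage_composesAt {I : Type u} [Fintype I] {J : I → Type u}
    [∀ i, Fintype (J i)] (f : BoolFun I) (g : ∀ i, BoolFun (J i)) (x : (Σ i, J i) → Bool) :
    sensitivityAssemblage.ComposesAt f g x := by
  classical
  have key : (fun l : Σ i, J i =>
      setWeight {i | IsBlock f (fun i => g i fun l => x ⟨i, l⟩) {i}} l.1 *
        setWeight {m | IsBlock (g l.1) (fun m => x ⟨l.1, m⟩) {m}} l.2) =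
      setWeight {l | IsBlock (sigmaComp f g) x {l}} := by
    rw [setWeight_sigma _ fun i => {m | IsBlock (g i) (fun m => x ⟨i, m⟩) {m}}]
    congr 1
    ext ⟨i, l⟩
    simp only [Set.mem_ofPred_eq]
    rw [isBlock_sigmaComp]
    by_cases hl : IsBlock (g i) (fun m => x ⟨i, m⟩) {l}
    · have : flippedIndices g x {⟨i, l⟩} = {i} := by
        ext i'
        by_cases hi : i' = i
        · subst hi
          simp [slice_singleton_self, hl]
        · simp [slice_singleton_of_ne l hi, hi]
      simp [this, hl]
    · have : flippedIndices g x {⟨i, l⟩} = ∅ := by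
        ext i'
        by_cases hi : i' = i
        · subst hi
          simp [slice_singleton_self, hl]
        · simp [slice_singleton_of_ne l hi]
      simp [this, hl]
  constructor
  · rintro w rfl v hv
    obtain rfl : v = fun i => setWeight {m | IsBlock (g i) (fun m => x ⟨i, m⟩) {m}} :=
      funext hv
    exact key
  · rintro W rfl
    refine ⟨_, rfl, fun i => setWeight {m | IsBlock (g i) (fun m => x ⟨i, m⟩) {m}},
      fun i => rfl, le_of_eq ?_⟩
    rw [← key, totalWeight_sigma]
    simp only [totalWeight, Finset.mul_sum]

/-- A weight function decomposes into a factor of at most `1` and a fractional witness. -/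
theorem exists_fractional_decomposition {I : Type u} [Fintype I] (g : BoolFun I) (x : I → Bool)
    (w : I → ℝ) (hw : ∀ i, 0 ≤ w i) :
    ∃ c : ℝ, 0 ≤ c ∧ c ≤ 1 ∧
      (∃ v ∈ fractionalWitnessAssemblage.family I g x, c * totalWeight v ≤ totalWeight w) ∧
      (c = 1 ∨ ∃ B, IsBlock g x B ∧ ∑ i ∈ B, w i = c) := by
  classical
  -- Rescale by `1 / c` and truncate at 1. Truncation is harmless: a block containing a truncated
  -- entry already has weight at least 1. For `c = 0` the constant 1 works.
  have main : ∀ c : ℝ, 0 ≤ c → (∀ B, IsBlock g x B → c ≤ ∑ i ∈ B, w i) →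
      ∃ v ∈ fractionalWitnessAssemblage.family I g x, c * totalWeight v ≤ totalWeight w := by
    intro c hc hB
    rcases hc.eq_or_lt with rfl | hc
    · refine ⟨fun _ => 1, ⟨fun _ => ⟨zero_le_one, le_rfl⟩, fun B hB' => ?_⟩, ?_⟩
      · simpa using hB'.nonempty.card_pos
      · simpa using totalWeight_nonneg hw
    · refine ⟨fun i => min 1 (w i / c), ⟨fun i => ⟨le_min zero_le_one (div_nonneg (hw i) hc.le),
        min_le_left _ _⟩, fun B hB' => ?_⟩, ?_⟩
      · by_cases h : ∃ i ∈ B, 1 ≤ w i / c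
        · obtain ⟨i, hi, h1⟩ := h
          calc (1 : ℝ) = min 1 (w i / c) := (min_eq_left h1).symm
            _ ≤ _ := Finset.single_le_sum (f := fun i => min 1 (w i / c))
              (fun j _ => le_min zero_le_one (div_nonneg (hw j) hc.le)) hi
        · push Not at h
          rw [Finset.sum_congr rfl fun i hi => min_eq_right (h i hi).le, ← Finset.sum_div,
            le_div_iff₀ hc, one_mul]
          exact hB B hB'
      · rw [totalWeight, Finset.mul_sum]
        refine Finset.sum_le_sum fun i _ => ?_
        calc c * min 1 (w i / c) ≤ c * (w i / c) :=
              mul_le_mul_of_nonneg_left (min_le_right _ _) hc.le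
          _ = w i := mul_div_cancel₀ _ hc.ne'
  -- The factor is the smaller of 1 and the least weight of a block; without blocks it is 1.
  by_cases h1 : ∀ B, IsBlock g x B → 1 ≤ ∑ i ∈ B, w i
  · exact ⟨1, zero_le_one, le_rfl, main 1 zero_le_one h1, Or.inl rfl⟩
  · push Not at h1
    obtain ⟨B₀, hB₀, hlt⟩ := h1
    obtain ⟨B, hB, hmin⟩ := (Finset.univ.filter (IsBlock g x)).exists_min_image
      (fun B => ∑ i ∈ B, w i) ⟨B₀, by simpa using hB₀⟩
    have h0 : 0 ≤ ∑ i ∈ B, w i := Finset.sum_nonneg fun i _ => hw i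
    exact ⟨_, h0, (hmin B₀ (by simpa using hB₀)).trans hlt.le,
      main _ h0 fun C hC => hmin C (by simpa using hC), Or.inr ⟨B, by simpa using hB, rfl⟩⟩

/-- The outer weights are the factors `c i`. On an outer block where no factor is 1, the inner
blocks attaining the factors assemble into a block of the composition, whose weight under `W` is the
sum of those factors. -/
theorem fractionalWitnessAssemblage_composesAt {I : Type u} [Fintype I] {J : I → Type u}
    [∀ i, Fintype (J i)] (f : BoolFun I) (g : ∀ i, BoolFun (J i)) (x : (Σ i, J i) → Bool) :
    fractionalWitnessAssemblage.ComposesAt f g x := by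
  classical
  constructor
  · rintro w ⟨hw, hwB⟩ v hv
    refine ⟨fun l => ⟨mul_nonneg (hw _).1 ((hv _).1 _).1,
      mul_le_one₀ (hw _).2 ((hv _).1 _).1 ((hv _).1 _).2⟩, fun B hB => ?_⟩
    rw [sum_eq_sum_slice]
    calc (1 : ℝ) ≤ ∑ i ∈ flippedIndices g x B, w i := hwB _ ((isBlock_sigmaComp f g x B).1 hB)
      _ ≤ ∑ i ∈ flippedIndices g x B, ∑ l ∈ slice B i, w i * v i l := by
          refine Finset.sum_le_sum fun i hi => ?_
          rw [← Finset.mul_sum]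
          exact le_mul_of_one_le_right (hw i).1 ((hv i).2 _ (mem_flippedIndices.1 hi))
      _ ≤ ∑ i, ∑ l ∈ slice B i, w i * v i l :=
          Finset.sum_le_univ_sum_of_nonneg fun i => Finset.sum_nonneg fun l _ =>
            mul_nonneg (hw i).1 ((hv i).1 l).1
  · rintro W ⟨hW, hWB⟩
    choose c hc0 hc1 hv hc using fun i =>
      exists_fractional_decomposition (g i) (fun l => x ⟨i, l⟩) (fun l => W ⟨i, l⟩)
        fun l => (hW _).1
    choose v hv hle using hv
    refine ⟨c, ⟨fun i => ⟨hc0 i, hc1 i⟩, fun B hB => ?_⟩, v, hv, ?_⟩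
    · by_cases h : ∃ i ∈ B, c i = 1
      · obtain ⟨i, hi, h1⟩ := h
        rw [← h1]
        exact Finset.single_le_sum (fun j _ => hc0 j) hi
      · push Not at h
        have : ∀ i, ∃ C : Finset (J i), i ∈ B →
            IsBlock (g i) (fun l => x ⟨i, l⟩) C ∧ ∑ l ∈ C, W ⟨i, l⟩ = c i := by
          intro i
          by_cases hi : i ∈ B
          · obtain ⟨C, hC⟩ := (hc i).resolve_left (h i hi)
            exact ⟨C, fun _ => hC⟩
          · exact ⟨∅, fun h' => absurd h' hi⟩
        choose C hC using this
        calc (1 : ℝ) ≤ ∑ p ∈ B.sigma C, W p :=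
              hWB _ (isBlock_sigmaComp_sigma hB fun i hi => (hC i hi).1)
          _ = ∑ i ∈ B, c i := by
              rw [Finset.sum_sigma]
              exact Finset.sum_congr rfl fun i hi => (hC i hi).2
    · rw [totalWeight_sigma]
      exact Finset.sum_le_sum fun i _ => hle i

/-! ### The spectral radius of a nonnegative two by two matrix -/

theorem Matrix.det_bool {R : Type*} [CommRing R] (M : Matrix Bool Bool R) :
    M.det = M false false * M true true - M false true * M true false := by
  rw [← Matrix.det_submatrix_equiv_self finTwoEquiv M, Matrix.det_fin_two]
  simp [finTwoEquiv]

theorem mem_spectrum_bool (M : Matrix Bool Bool ℂ) (μ : ℂ) :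
    μ ∈ spectrum ℂ M ↔
      (μ - M false false) * (μ - M true true) = M false true * M true false := by
  rw [spectrum.mem_iff, Matrix.isUnit_iff_isUnit_det, isUnit_iff_ne_zero, not_not,
    Matrix.det_bool]
  simp [Matrix.algebraMap_matrix_apply, sub_eq_zero]

/-- The discriminant of the characteristic polynomial. -/
def discrBool (M : Matrix Bool Bool ℝ) : ℝ :=
  (M false false - M true true) ^ 2 + 4 * (M false true * M true false)

/-- Nonnegative off-diagonal entries make the discriminant nonnegative, so both eigenvalues are
real; the nonnegative trace makes the larger one dominate in absolute value. -/
theorem rho_eq {M : Matrix Bool Bool ℝ} (hM : ∀ s t, 0 ≤ M s t) :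
    rho M = (M false false + M true true + √(discrBool M)) / 2 := by
  have hD : 0 ≤ discrBool M :=
    add_nonneg (sq_nonneg _) (mul_nonneg zero_le_four (mul_nonneg (hM _ _) (hM _ _)))
  have hs := Real.sqrt_nonneg (discrBool M)
  have hs2 := Real.sq_sqrt hD
  have ha := hM false false
  have hd := hM true true
  set s := √(discrBool M) with hs_def
  have hspec : spectrum ℂ (M.map (algebraMap ℝ ℂ)) =
      {(((M false false + M true true + s) / 2 : ℝ) : ℂ),
        (((M false false + M true true - s) / 2 : ℝ) : ℂ)} := by
    ext μ
    rw [mem_spectrum_bool, Set.mem_insert_iff, Set.mem_singleton_iff, ← sub_eq_zero (a := μ),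
      ← sub_eq_zero (a := μ) (b := (((M false false + M true true - s) / 2 : ℝ) : ℂ)),
      ← mul_eq_zero, ← sub_eq_zero]
    have h : ((s : ℂ)) ^ 2 = ((M false false : ℂ) - M true true) ^ 2 +
        4 * ((M false true : ℂ) * M true false) := by
      rw [discrBool] at hs2
      exact_mod_cast hs2
    have : (μ - (((M false false + M true true + s) / 2 : ℝ) : ℂ)) *
        (μ - (((M false false + M true true - s) / 2 : ℝ) : ℂ)) =
        (μ - (M false false : ℂ)) * (μ - (M true true : ℂ)) - (M false true : ℂ) * M true false := by
      push_cast
      linear_combination (-1 / 4 : ℂ) * h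
    rw [this]
    simp
  have habs : |(M false false + M true true - s) / 2| ≤ (M false false + M true true + s) / 2 := by
    rw [abs_le]
    constructor <;> linarith
  have hpos : 0 ≤ (M false false + M true true + s) / 2 := by linarith
  have hle : ‖(((M false false + M true true - s) / 2 : ℝ) : ℂ)‖₊ ≤
      ‖(((M false false + M true true + s) / 2 : ℝ) : ℂ)‖₊ := by
    rw [← NNReal.coe_le_coe, coe_nnnorm, coe_nnnorm, Complex.norm_real, Complex.norm_real,
      Real.norm_eq_abs, Real.norm_eq_abs, abs_of_nonneg hpos]
    exact habs
  rw [rho, spectralRadius, hspec, iSup_pair, sup_eq_left.2 (by exact_mod_cast hle),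
    ENNReal.coe_toReal, coe_nnnorm, Complex.norm_real, Real.norm_eq_abs, abs_of_nonneg hpos]

theorem rho_lt_iff {M : Matrix Bool Bool ℝ} (hM : ∀ s t, 0 ≤ M s t) {L : ℝ} :
    rho M < L ↔ M false false < L ∧ M true true < L ∧
      M false true * M true false < (L - M false false) * (L - M true true) := by
  have hbc := mul_nonneg (hM false true) (hM true false)
  have key : rho M < L ↔ √(discrBool M) < 2 * L - M false false - M true true := by
    rw [rho_eq hM]
    constructor <;> intro h <;> linarith
  rw [key]
  constructor
  · intro h
    have h0 := (Real.sqrt_nonneg _).trans_lt h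
    rw [Real.sqrt_lt' h0, discrBool] at h
    have h2 : |M false false - M true true| < 2 * L - M false false - M true true := by
      rw [← abs_of_pos h0, ← sq_lt_sq]
      linarith
    rw [abs_lt] at h2
    exact ⟨by linarith, by linarith, by linarith⟩
  · rintro ⟨h1, h2, h3⟩
    rw [Real.sqrt_lt' (by linarith), discrBool]
    linarith

theorem rho_nonneg (M : Matrix Bool Bool ℝ) : 0 ≤ rho M := ENNReal.toReal_nonneg

theorem continuousOn_rho : ContinuousOn rho {M | ∀ s t, 0 ≤ M s t} := by
  have : Continuous fun M : Matrix Bool Bool ℝ =>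
      (M false false + M true true + √(discrBool M)) / 2 := by
    unfold discrBool
    have h : ∀ s t, Continuous fun M : Matrix Bool Bool ℝ => M s t :=
      fun s t => (continuous_apply t).comp (continuous_apply s)
    have h1 := h false false
    have h2 := h false true
    have h3 := h true false
    have h4 := h true true
    fun_prop
  exact this.continuousOn.congr fun M hM => rho_eq hM

/-- The Collatz–Wielandt criterion: multiplying the two row inequalities gives the determinant
condition of `rho_lt_iff`. -/
theorem rho_lt_of_mul_lt {M : Matrix Bool Bool ℝ} (hM : ∀ s t, 0 ≤ M s t) {L : ℝ}
    {u : Bool → ℝ} (hu : ∀ b, 0 < u b)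
    (h : ∀ b, M b false * u false + M b true * u true < L * u b) : rho M < L := by
  have h0 := h false
  have h1 := h true
  have hu0 := hu false
  have hu1 := hu true
  have e0 : M false true * u true < (L - M false false) * u false := by linarith
  have e1 : M true false * u false < (L - M true true) * u true := by linarith
  have n0 := mul_nonneg (hM false true) hu1.le
  have n1 := mul_nonneg (hM true false) hu0.le
  rw [rho_lt_iff hM]
  refine ⟨?_, ?_, ?_⟩
  · have := (pos_iff_pos_of_mul_pos (n0.trans_lt e0)).2 hu0
    linarith
  · have := (pos_iff_pos_of_mul_pos (n1.trans_lt e1)).2 hu1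
    linarith
  · have := mul_lt_mul'' e0 e1 n0 n1
    refine lt_of_mul_lt_mul_right (a := u false * u true) ?_ (mul_pos hu0 hu1).le
    linarith

/-- A converse to `rho_lt_of_mul_lt`, with test vector `(1, r)`. -/
theorem exists_mul_le_of_rho_lt {M : Matrix Bool Bool ℝ} (hM : ∀ s t, 0 ≤ M s t) {L : ℝ}
    (h : rho M < L) :
    ∃ r : ℝ, 0 < r ∧ M false false + M false true * r ≤ L ∧
      M true false + M true true * r ≤ L * r := by
  obtain ⟨h0, h1, h2⟩ := (rho_lt_iff hM).1 h
  have hb := hM false true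
  have hc := hM true false
  have p : 0 < L - M true true + M false true := by linarith
  have q : 0 < L - M false false + M true false := by linarith
  -- The constraints are `M true false / (L - M true true) ≤ r ≤ (L - M false false) / M false
  -- true`. The mediant of these bounds satisfies both and stays defined and positive when
  -- off-diagonal entries vanish.
  refine ⟨(L - M false false + M true false) / (L - M true true + M false true),
    div_pos q p, ?_, ?_⟩
  · have : M false true * ((L - M false false + M true false) / (L - M true true + M false true)) ≤
        L - M false false := by
      rw [← mul_div_assoc, div_le_iff₀ p]
      linarith
    linarith
  · have : M true false ≤ (L - M true true) *
        ((L - M false false + M true false) / (L - M true true + M false true)) := by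
      rw [← mul_div_assoc, le_div_iff₀ p]
      linarith
    linarith

theorem rho_le_of_row_sum_le {M : Matrix Bool Bool ℝ} (hM : ∀ s t, 0 ≤ M s t) {N : ℝ}
    (h : ∀ b, M b false + M b true ≤ N) : rho M ≤ N :=
  le_of_forall_gt fun L hL => rho_lt_of_mul_lt hM (u := fun _ => 1) (fun _ => one_pos)
    fun b => by
      have := h b
      simp only [mul_one]
      linarith

/-! ### Profile matrices -/

section Profile

variable {I : Type u} [Fintype I]

theorem sum_mul_apply_bool (a : I → Bool) (w : I → ℝ) (v : Bool → ℝ) :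
    ∑ i, w i * v (a i) =
      (∑ i with a i = false, w i) * v false + (∑ i with a i = true, w i) * v true := by
  rw [Finset.sum_mul, Finset.sum_mul, Finset.sum_filter, Finset.sum_filter,
    ← Finset.sum_add_distrib]
  refine Finset.sum_congr rfl fun i _ => ?_
  cases a i <;> simp

theorem profileMatrix_mul (α : Bool → I → Bool) (w : Bool → I → ℝ) (v : Bool → ℝ) (b : Bool) :
    profileMatrix α w b false * v false + profileMatrix α w b true * v true =
      ∑ i, w b i * v (α b i) :=
  (sum_mul_apply_bool _ _ _).symm

theorem profileMatrix_row_sum (α : Bool → I → Bool) (w : Bool → I → ℝ) (b : Bool) :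
    profileMatrix α w b false + profileMatrix α w b true = totalWeight (w b) := by
  simpa [totalWeight] using profileMatrix_mul α w (fun _ => 1) b

theorem profileMatrix_nonneg (α : Bool → I → Bool) {w : Bool → I → ℝ} (hw : ∀ b i, 0 ≤ w b i)
    (s t : Bool) : 0 ≤ profileMatrix α w s t :=
  Finset.sum_nonneg fun i _ => hw s i

namespace Assemblage

variable (A : Assemblage.{u}) {f : BoolFun I}

theorem isCompact_profileFamily (f : BoolFun I) (α : Bool → I → Bool) :
    IsCompact (A.profileFamily f α) := by
  have h : A.profileFamily f α =
      profileMatrix α '' Set.pi Set.univ fun b => A.family I f (α b) := by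
    ext M
    constructor
    · rintro ⟨w, hw, rfl⟩
      exact ⟨w, fun b _ => hw b, rfl⟩
    · rintro ⟨w, hw, rfl⟩
      exact ⟨w, fun b => hw b trivial, rfl⟩
  rw [h]
  refine (isCompact_univ_pi fun b => A.compact I f (α b)).image ?_
  refine continuous_pi fun s => continuous_pi fun t => ?_
  simp only [profileMatrix, Matrix.of_apply]
  fun_prop

theorem profileFamily_nonneg {α : Bool → I → Bool} {M : Matrix Bool Bool ℝ}
    (hM : M ∈ A.profileFamily f α) (s t : Bool) : 0 ≤ M s t := by
  obtain ⟨w, hw, rfl⟩ := hM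
  exact profileMatrix_nonneg α (fun b => A.nonneg _ _ _ _ (hw b)) s t

theorem isLeast_charValueAt (hA : ∀ x, (A.family I f x).Nonempty) (α : Bool → I → Bool) :
    IsLeast (rho '' A.profileFamily f α) (A.charValueAt f α) := by
  refine ((A.isCompact_profileFamily f α).image_of_continuousOn
    (continuousOn_rho.mono fun M hM => A.profileFamily_nonneg hM)).isLeast_sInf ?_
  choose w hw using hA
  exact ⟨_, _, ⟨fun b => w (α b), fun b => hw _, rfl⟩, rfl⟩

theorem isGreatest_charValue (A : Assemblage.{u}) (hf : f.Nonconstant) :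
    IsGreatest (A.charValueAt f '' {α | IsCompatible f α}) (A.charValue f) := by
  choose α hα using hf
  exact ((Set.toFinite _).image _).isCompact.isGreatest_sSup ⟨_, α, hα, rfl⟩

theorem charValueAt_le {α : Bool → I → Bool} {w : Bool → I → ℝ}
    (hA : ∀ x, (A.family I f x).Nonempty) (hw : ∀ b, w b ∈ A.family I f (α b)) :
    A.charValueAt f α ≤ rho (profileMatrix α w) :=
  (A.isLeast_charValueAt hA α).2 ⟨_, ⟨w, hw, rfl⟩, rfl⟩

theorem charValue_nonneg (hf : f.Nonconstant) (hA : ∀ x, (A.family I f x).Nonempty) :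
    0 ≤ A.charValue f := by
  obtain ⟨α, -, hα⟩ := (A.isGreatest_charValue hf).1
  obtain ⟨M, -, hM⟩ := (A.isLeast_charValueAt hA α).1
  rw [← hα, ← hM]
  exact rho_nonneg M

theorem charValue_le (hf : f.Nonconstant) (hA : ∀ x, (A.family I f x).Nonempty) {N : ℝ}
    (hN : ∀ x, ∀ w ∈ A.family I f x, totalWeight w ≤ N) : A.charValue f ≤ N := by
  obtain ⟨α, -, hα⟩ := (A.isGreatest_charValue hf).1
  obtain ⟨_, ⟨w, hw, rfl⟩, hM⟩ := (A.isLeast_charValueAt hA α).1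
  rw [← hα, ← hM]
  refine rho_le_of_row_sum_le (profileMatrix_nonneg α fun b => A.nonneg _ _ _ _ (hw b)) fun b => ?_
  rw [profileMatrix_row_sum]
  exact hN _ _ (hw b)

/-! ### Expanding and contracting vectors for the characteristic value -/

/-- A vector that every choice of weight functions expands by at least the characteristic value. -/
theorem exists_expanding_vector (hf : f.Nonconstant) (hA : ∀ x, (A.family I f x).Nonempty) :
    ∃ (α : Bool → I → Bool) (u : Bool → ℝ), IsCompatible f α ∧ (∀ b, 0 ≤ u b) ∧
      u false + u true = 1 ∧
      ∀ b, ∀ w ∈ A.family I f (α b), A.charValue f * u b ≤ ∑ i, w i * u (α b i) := by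
  obtain ⟨α, hα, hval⟩ := (A.isGreatest_charValue hf).1
  have hnn := A.charValue_nonneg hf hA
  let u : ℝ → Bool → ℝ := fun t b => cond b t (1 - t)
  have hu : ∀ b, Continuous fun t => u t b := by
    rintro (_ | _)
    · exact continuous_const.sub continuous_id
    · exact continuous_id
  -- The parameters for which row `b` is expanded by every admissible weight function. The rows are
  -- chosen independently, so a common point of both sets is what is needed.
  let S : Bool → Set ℝ := fun b =>
    {t | ∀ w ∈ A.family I f (α b), A.charValue f * u t b ≤ ∑ i, w i * u t (α b i)}
  have hS : ∀ b, IsClosed (S b) := by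
    intro b
    simp only [S, Set.ofPred_forall]
    refine isClosed_iInter fun w => isClosed_iInter fun _ => isClosed_le ?_ ?_
    · exact continuous_const.mul (hu b)
    · exact continuous_finsetSum _ fun i _ => continuous_const.mul (hu _)
  have hu0 : ∀ t ∈ Set.Icc (0 : ℝ) 1, ∀ b, 0 ≤ u t b := by
    rintro t ht (_ | _)
    · exact sub_nonneg.2 ht.2
    · exact ht.1
  have hend : ∀ t ∈ Set.Icc (0 : ℝ) 1, ∀ b, u t b = 0 → t ∈ S b := by
    intro t ht b h w hw
    rw [h, mul_zero]
    exact Finset.sum_nonneg fun i _ => mul_nonneg (A.nonneg _ _ _ _ hw i) (hu0 t ht _)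
  -- At an uncovered point both rows could be strictly contracted at a positive vector, giving a
  -- profile matrix with `rho` below the minimum for `α`.
  have hcover : Set.Icc (0 : ℝ) 1 ⊆ S false ∪ S true := by
    intro t ht
    by_contra hcon
    have hnot : ∀ b, t ∉ S b := by
      rintro (_ | _) h
      · exact hcon (Or.inl h)
      · exact hcon (Or.inr h)
    have hpos : ∀ b, 0 < u t b := fun b =>
      (hu0 t ht b).lt_of_ne fun h => hnot b (hend t ht b h.symm)
    have hex : ∀ b, ∃ w ∈ A.family I f (α b), ∑ i, w i * u t (α b i) < A.charValue f * u t b := by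
      intro b
      have := hnot b
      simp only [S, Set.mem_ofPred_eq] at this
      push Not at this
      exact this
    choose w hw hlt using hex
    have h1 : rho (profileMatrix α w) < A.charValue f :=
      rho_lt_of_mul_lt (profileMatrix_nonneg α fun b => A.nonneg _ _ _ _ (hw b)) hpos
        fun b => by rw [profileMatrix_mul]; exact hlt b
    have h2 := A.charValueAt_le hA hw
    linarith
  -- Each closed set contains the endpoint where its own coordinate vanishes, so connectedness of
  -- the interval forces an intersection.
  obtain ⟨t, ht, ht0, ht1⟩ := isPreconnected_closed_iff.1 (isPreconnected_Icc (a := (0 : ℝ)) (b := 1))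
    (S false) (S true) (hS _) (hS _) hcover
    ⟨1, by simp, hend 1 (by simp) false (by simp [u])⟩
    ⟨0, by simp, hend 0 (by simp) true (by simp [u])⟩
  refine ⟨α, u t, hα, hu0 t ht, by simp [u], ?_⟩
  rintro (_ | _)
  · exact ht0
  · exact ht1

/-- A positive vector that suitable weight functions expand by at most `L`, for any `L` above the
characteristic value. -/
theorem exists_contracting_vector (hf : f.Nonconstant) (hA : ∀ x, (A.family I f x).Nonempty)
    {L : ℝ} (hL : A.charValue f < L) :
    ∃ u : Bool → ℝ, (∀ b, 0 < u b) ∧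
      ∀ a, ∃ w ∈ A.family I f a, ∑ i, w i * u (a i) ≤ L * u (f a) := by
  let v : ℝ → Bool → ℝ := fun r b => cond b r 1
  let G : ℝ → (I → Bool) → Prop := fun r a =>
    ∃ w ∈ A.family I f a, ∑ i, w i * v r (a i) ≤ L * v r (f a)
  have hpair : ∀ a₀ a₁, ∃ r : ℝ, 0 < r ∧ (f a₀ = false → f a₁ = true → G r a₀ ∧ G r a₁) := by
    intro a₀ a₁
    by_cases h : f a₀ = false ∧ f a₁ = true
    · have hα : IsCompatible f fun b => cond b a₁ a₀ := by
        rintro (_ | _)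
        exacts [h.1, h.2]
      obtain ⟨_, ⟨w, hw, rfl⟩, hρ⟩ := (A.isLeast_charValueAt hA fun b => cond b a₁ a₀).1
      have hle := (A.isGreatest_charValue hf).2 ⟨_, hα, rfl⟩
      obtain ⟨r, hr, h0, h1⟩ := exists_mul_le_of_rho_lt
        (profileMatrix_nonneg (fun b => cond b a₁ a₀) fun b => A.nonneg _ _ _ _ (hw b))
        ((hρ.trans_le hle).trans_lt hL)
      refine ⟨r, hr, fun _ _ => ⟨⟨w false, hw false, ?_⟩, ⟨w true, hw true, ?_⟩⟩⟩
      · have := profileMatrix_mul (fun b => cond b a₁ a₀) w (v r) false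
        simp only [cond_false] at this
        rw [← this, h.1]
        simpa [v] using h0
      · have := profileMatrix_mul (fun b => cond b a₁ a₀) w (v r) true
        simp only [cond_true] at this
        rw [← this, h.2]
        simpa [v] using h1
    · exact ⟨1, one_pos, fun h0 h1 => absurd ⟨h0, h1⟩ h⟩
  choose ρ hρ0 hρ using hpair
  have hfin : ∀ b, ({a | f a = b} : Set (I → Bool)).Finite := fun b => Set.toFinite _
  -- Take `r` to be the min over 0-inputs of the max over 1-inputs of `ρ`. At a 0-input `G` survives
  -- decreasing `r`, since the condition reads `p + q * r ≤ L`. At a 1-input it survives increasing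
  -- `r`, since it reads `p ≤ (L - q) * r` with `L - q ≥ 0`.
  choose m hm hmax using fun a₀ => Set.exists_max_image _ (ρ a₀) (hfin true) (hf true)
  obtain ⟨a', ha', hmin⟩ := Set.exists_min_image _ (fun a₀ => ρ a₀ (m a₀)) (hfin false) (hf false)
  have hr := hρ0 a' (m a')
  refine ⟨v (ρ a' (m a')), ?_, fun a => ?_⟩
  · rintro (_ | _)
    exacts [one_pos, hr]
  · change G _ a
    rcases hfa : f a with _ | _
    · obtain ⟨w, hw, hle⟩ := (hρ a (m a) hfa (hm a)).1
      refine ⟨w, hw, le_trans (Finset.sum_le_sum fun i _ => ?_) (hle.trans_eq (by rw [hfa]; rfl))⟩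
      refine mul_le_mul_of_nonneg_left ?_ (A.nonneg _ _ _ _ hw i)
      rcases a i with _ | _
      exacts [le_rfl, hmin a hfa]
    · obtain ⟨w, hw, hle⟩ := (hρ a' a ha' hfa).2
      refine ⟨w, hw, ?_⟩
      have hle' := hmax a' a hfa
      have h0 := hρ0 a' a
      rw [sum_mul_apply_bool] at hle ⊢
      rw [hfa] at hle ⊢
      simp only [v, cond_true, cond_false, mul_one] at hle ⊢
      have hp : 0 ≤ ∑ i with a i = false, w i :=
        Finset.sum_nonneg fun i _ => A.nonneg _ _ _ _ hw i
      have hq : 0 ≤ L - ∑ i with a i = true, w i :=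
        nonneg_of_mul_nonneg_left (b := ρ a' a) (by linarith) h0
      have := mul_le_mul_of_nonneg_left hle' hq
      linarith

end Assemblage

end Profile

/-! ### The measure of iterated compositions -/

namespace Assemblage

variable {A : Assemblage.{u}} {I : Type u} [Fintype I] {f : BoolFun I}

theorem localMeasure_le {g : BoolFun I} {x : I → Bool} {w : I → ℝ} (hw : w ∈ A.family I g x) :
    A.localMeasure g x ≤ totalWeight w :=
  (A.isLeast_localMeasure g x ⟨w, hw⟩).2 ⟨w, hw, rfl⟩

theorem localMeasure_nonneg (A : Assemblage.{u}) (g : BoolFun I) (x : I → Bool) :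
    0 ≤ A.localMeasure g x := by
  refine Real.sInf_nonneg ?_
  rintro _ ⟨w, hw, rfl⟩
  exact totalWeight_nonneg (A.nonneg _ _ _ _ hw)

theorem exists_totalWeight_eq_localMeasure {g : BoolFun I} {x : I → Bool}
    (h : (A.family I g x).Nonempty) :
    ∃ w ∈ A.family I g x, totalWeight w = A.localMeasure g x :=
  (A.isLeast_localMeasure g x h).1

theorem isGreatest_measureOn (A : Assemblage.{u}) {g : BoolFun I} (hg : g.Nonconstant) (b : Bool) :
    IsGreatest (A.localMeasure g '' {x | g x = b}) (A.measureOn g b) :=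
  ((Set.toFinite _).image _).isCompact.isGreatest_sSup (Set.Nonempty.image _ (hg b))

theorem localMeasure_le_measureOn (A : Assemblage.{u}) {g : BoolFun I} (hg : g.Nonconstant)
    (x : I → Bool) : A.localMeasure g x ≤ A.measureOn g (g x) :=
  (A.isGreatest_measureOn hg _).2 ⟨x, rfl, rfl⟩

theorem exists_localMeasure_eq_measureOn (A : Assemblage.{u}) {g : BoolFun I}
    (hg : g.Nonconstant) (b : Bool) : ∃ x, g x = b ∧ A.localMeasure g x = A.measureOn g b :=
  (A.isGreatest_measureOn hg b).1

theorem nonconstantGates_constEnsemble (hf : f.Nonconstant) (k : ℕ) :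
    (IndexedTree.power I k).NonconstantGates (IndexedTree.constEnsemble f k) := by
  induction k with
  | zero => exact hf
  | succ k ih => exact ⟨hf, fun _ => ih⟩

theorem nonconstant_iterComp (hf : f.Nonconstant) (k : ℕ) : (iterComp f k).Nonconstant :=
  (nonconstantGates_constEnsemble hf k).nonconstant_composeFun

theorem exists_compatibleWeights (hA : ∀ x, (A.family I f x).Nonempty) (k : ℕ)
    (x : (IndexedTree.power I k).Leaves → Bool) :
    ∃ w, (IndexedTree.power I k).CompatibleWeights A (IndexedTree.constEnsemble f k) x w := by
  induction k with
  | zero => exact hA x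
  | succ k ih =>
    obtain ⟨w, hw⟩ := hA fun i => iterComp f k fun l => x ⟨i, l⟩
    choose v hv using fun i => ih fun l => x ⟨i, l⟩
    exact ⟨(w, v), hw, hv⟩

theorem IsWellBehaved.behavesWellAt_power (h : A.IsWellBehaved) (hf : f.Nonconstant) (k : ℕ)
    (x : (IndexedTree.power I k).Leaves → Bool) :
    A.BehavesWellAt (IndexedTree.power I k) (IndexedTree.constEnsemble f k) x :=
  h _ _ _ (nonconstantGates_constEnsemble hf k) x

theorem IsWellBehaved.family_iterComp_nonempty (h : A.IsWellBehaved) (hf : f.Nonconstant)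
    (hA : ∀ x, (A.family I f x).Nonempty) (k : ℕ)
    (x : (IndexedTree.power I k).Leaves → Bool) : (A.family _ (iterComp f k) x).Nonempty := by
  obtain ⟨w, hw⟩ := exists_compatibleWeights hA k x
  exact ⟨_, (h.behavesWellAt_power hf k x).1 w hw⟩

/-- Optimal inner weights need not be compositions, so condition (2) at level `k` first replaces
them by compatible ensembles; condition (1) then applies to the whole tree. -/
theorem IsWellBehaved.localMeasure_iterComp_succ_le (h : A.IsWellBehaved) (hf : f.Nonconstant)
    (hA : ∀ x, (A.family I f x).Nonempty) (k : ℕ)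
    (x : (IndexedTree.power I (k + 1)).Leaves → Bool) {w : I → ℝ}
    (hw : w ∈ A.family I f fun i => iterComp f k fun l => x ⟨i, l⟩) :
    A.localMeasure (iterComp f (k + 1)) x ≤
      ∑ i, w i * A.localMeasure (iterComp f k) fun l => x ⟨i, l⟩ := by
  choose v hv hveq using fun i => exists_totalWeight_eq_localMeasure
    (h.family_iterComp_nonempty hf hA k fun l => x ⟨i, l⟩)
  choose v' hv' hle using fun i =>
    (h.behavesWellAt_power hf k fun l => x ⟨i, l⟩).2 (v i) (hv i)
  refine (localMeasure_le ((h.behavesWellAt_power hf (k + 1) x).1 (w, v') ⟨hw, hv'⟩)).trans ?_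
  refine (totalWeight_composeWeight_node I _ _).trans_le (Finset.sum_le_sum fun i _ => ?_)
  refine mul_le_mul_of_nonneg_left ?_ (A.nonneg _ _ _ _ hw i)
  exact (hle i).trans_eq (hveq i)

theorem IsWellBehaved.exists_le_localMeasure_iterComp_succ (h : A.IsWellBehaved)
    (hf : f.Nonconstant) (hA : ∀ x, (A.family I f x).Nonempty) (k : ℕ)
    (x : (IndexedTree.power I (k + 1)).Leaves → Bool) :
    ∃ w ∈ A.family I f fun i => iterComp f k fun l => x ⟨i, l⟩,
      ∑ i, w i * A.localMeasure (iterComp f k) (fun l => x ⟨i, l⟩) ≤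
        A.localMeasure (iterComp f (k + 1)) x := by
  obtain ⟨W, hW, hWeq⟩ := exists_totalWeight_eq_localMeasure
    (h.family_iterComp_nonempty hf hA (k + 1) x)
  obtain ⟨w, hw, hle⟩ := (h.behavesWellAt_power hf (k + 1) x).2 W hW
  refine ⟨w.1, hw.1, le_trans (Finset.sum_le_sum fun i _ => ?_)
    (((totalWeight_composeWeight_node I _ w).symm.trans_le hle).trans_eq hWeq)⟩
  exact mul_le_mul_of_nonneg_left
    (localMeasure_le ((h.behavesWellAt_power hf k _).1 _ (hw.2 i))) (A.nonneg _ _ _ _ hw.1 i)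

theorem measureOn_iterComp_zero_le (hf : f.Nonconstant) {v : Bool → ℝ}
    (hv : ∀ a, ∃ w ∈ A.family I f a, totalWeight w ≤ v (f a)) (b : Bool) :
    A.measureOn (iterComp f 0) b ≤ v b := by
  obtain ⟨x, rfl, hx⟩ := A.exists_localMeasure_eq_measureOn (nonconstant_iterComp hf 0) b
  obtain ⟨w, hw, hle⟩ := hv x
  rw [← hx]
  exact (localMeasure_le hw).trans hle

theorem le_measureOn_iterComp_zero (hf : f.Nonconstant) (hA : ∀ x, (A.family I f x).Nonempty)
    {r : ℝ} {a : I → Bool} (hr : ∀ w ∈ A.family I f a, r ≤ totalWeight w) :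
    r ≤ A.measureOn (iterComp f 0) (f a) := by
  obtain ⟨w, hw, hle⟩ := exists_totalWeight_eq_localMeasure (hA a)
  exact ((hr w hw).trans_eq hle).trans (A.localMeasure_le_measureOn (nonconstant_iterComp hf 0) a)

theorem IsWellBehaved.measureOn_iterComp_succ_le (h : A.IsWellBehaved) (hf : f.Nonconstant)
    (hA : ∀ x, (A.family I f x).Nonempty) {k : ℕ} {v v' : Bool → ℝ}
    (hk : ∀ b, A.measureOn (iterComp f k) b ≤ v b)
    (hv : ∀ a, ∃ w ∈ A.family I f a, ∑ i, w i * v (a i) ≤ v' (f a)) (b : Bool) :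
    A.measureOn (iterComp f (k + 1)) b ≤ v' b := by
  obtain ⟨x, rfl, hx⟩ := A.exists_localMeasure_eq_measureOn (nonconstant_iterComp hf (k + 1)) b
  obtain ⟨w, hw, hle⟩ := hv fun i => iterComp f k fun l => x ⟨i, l⟩
  rw [← hx]
  refine (h.localMeasure_iterComp_succ_le hf hA k x hw).trans (le_trans ?_ hle)
  exact Finset.sum_le_sum fun i _ => mul_le_mul_of_nonneg_left
    ((A.localMeasure_le_measureOn (nonconstant_iterComp hf k) _).trans (hk _))
    (A.nonneg _ _ _ _ hw i)

theorem IsWellBehaved.le_measureOn_iterComp_succ (h : A.IsWellBehaved) (hf : f.Nonconstant)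
    (hA : ∀ x, (A.family I f x).Nonempty) {k : ℕ} {v : Bool → ℝ}
    (hk : ∀ b, v b ≤ A.measureOn (iterComp f k) b) {r : ℝ} {a : I → Bool}
    (hr : ∀ w ∈ A.family I f a, r ≤ ∑ i, w i * v (a i)) :
    r ≤ A.measureOn (iterComp f (k + 1)) (f a) := by
  choose y hy hyeq using A.exists_localMeasure_eq_measureOn (nonconstant_iterComp hf k)
  let x : (IndexedTree.power I (k + 1)).Leaves → Bool :=
    -- Above child `i` sits a hardest input for the value `a i`, so every child attains `measureOn`
    -- at once.
    fun l : Σ _ : I, (IndexedTree.power I k).Leaves => y (a l.1) l.2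
  have hx : (fun i => iterComp f k fun l => x ⟨i, l⟩) = a := funext fun i => hy (a i)
  obtain ⟨w, hw, hle⟩ := h.exists_le_localMeasure_iterComp_succ hf hA k x
  have hfx : iterComp f (k + 1) x = f a := congrArg f hx
  rw [hx] at hw
  rw [← hfx]
  refine le_trans ((hr w hw).trans ?_)
    (hle.trans (A.localMeasure_le_measureOn (nonconstant_iterComp hf (k + 1)) x))
  refine Finset.sum_le_sum fun i _ => mul_le_mul_of_nonneg_left ?_ (A.nonneg _ _ _ _ hw i)
  exact (hk _).trans_eq (hyeq _).symm

theorem measureOn_le_measure (A : Assemblage.{u}) (g : BoolFun I) (b : Bool) :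
    A.measureOn g b ≤ A.measure g := by
  rcases b with _ | _
  exacts [le_max_left _ _, le_max_right _ _]

theorem measure_nonneg (A : Assemblage.{u}) (g : BoolFun I) : 0 ≤ A.measure g := by
  refine le_trans (Real.sSup_nonneg ?_) (le_max_left _ _)
  rintro _ ⟨x, -, rfl⟩
  exact A.localMeasure_nonneg g x

/-! ### Bounds by powers of the characteristic value -/

/-- The expanding vector stays below `(m_0, m_1)` after scaling by powers of the characteristic
value. Index `k` stands for the iterate `f^(k+1)`, hence the shifted exponent. -/
theorem IsWellBehaved.charValue_pow_le (h : A.IsWellBehaved) (hf : f.Nonconstant)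
    (hA : ∀ x, (A.family I f x).Nonempty) (k : ℕ) :
    A.charValue f ^ (k + 1) / 2 ≤ A.measure (iterComp f k) := by
  obtain ⟨α, u, hα, hu, hsum, hexp⟩ := A.exists_expanding_vector hf hA
  have hnn := A.charValue_nonneg hf hA
  have hu1 : ∀ b, u b ≤ 1 := by
    have h0 := hu false
    have h1 := hu true
    rintro (_ | _) <;> linarith
  have key : ∀ b, A.charValue f ^ (k + 1) * u b ≤ A.measureOn (iterComp f k) b := by
    induction k with
    | zero =>
      intro b
      -- The iteration starts from the constant vector 1, which dominates `u`.
      have := le_measureOn_iterComp_zero (a := α b) (r := A.charValue f * u b) hf hA fun w hw =>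
        (hexp b w hw).trans (Finset.sum_le_sum fun i _ =>
          mul_le_of_le_one_right (A.nonneg _ _ _ _ hw i) (hu1 _))
      rw [hα b] at this
      simpa using this
    | succ k ih =>
      intro b
      have := h.le_measureOn_iterComp_succ (a := α b) (r := A.charValue f ^ (k + 2) * u b) hf hA
        ih fun w hw => by
          calc A.charValue f ^ (k + 2) * u b = A.charValue f ^ (k + 1) * (A.charValue f * u b) := by
                ring
            _ ≤ A.charValue f ^ (k + 1) * ∑ i, w i * u (α b i) :=
                mul_le_mul_of_nonneg_left (hexp b w hw) (pow_nonneg hnn _)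
            _ = ∑ i, w i * (A.charValue f ^ (k + 1) * u (α b i)) := by
                rw [Finset.mul_sum]
                exact Finset.sum_congr rfl fun i _ => by ring
      rwa [hα b] at this
  have h0 := (key false).trans (A.measureOn_le_measure _ _)
  have h1 := (key true).trans (A.measureOn_le_measure _ _)
  have : A.charValue f ^ (k + 1) * (u false + u true) ≤ 2 * A.measure (iterComp f k) := by linarith
  rw [hsum] at this
  linarith

/-- The second estimate controls the action on the constant vector by `L` and `N` alone, without the
ratio of the coordinates of `u`, which is unbounded in general. -/
theorem exists_normalized_contracting_vector (hf : f.Nonconstant)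
    (hA : ∀ x, (A.family I f x).Nonempty) {N : ℝ}
    (hN : ∀ x, ∀ w ∈ A.family I f x, totalWeight w ≤ N) {L : ℝ} (hL : A.charValue f < L) :
    ∃ u : Bool → ℝ, (∀ b, u b ≤ 1) ∧ ∀ a, ∃ w ∈ A.family I f a,
      ∑ i, w i * u (a i) ≤ L * u (f a) ∧ totalWeight w ≤ L + u (f a) * N := by
  obtain ⟨u, hu, hc⟩ := A.exists_contracting_vector hf hA hL
  have hL0 : 0 < L := (A.charValue_nonneg hf hA).trans_lt hL
  obtain ⟨b₀, hb₀⟩ : ∃ b₀, ∀ b, u b ≤ u b₀ := by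
    obtain ⟨b₀, -, hb₀⟩ := Finset.univ.exists_max_image u Finset.univ_nonempty
    exact ⟨b₀, fun b => hb₀ b (Finset.mem_univ b)⟩
  have hle1 : ∀ b, u b / u b₀ ≤ 1 := fun b => (div_le_one (hu b₀)).2 (hb₀ b)
  refine ⟨fun b => u b / u b₀, hle1, fun a => ?_⟩
  obtain ⟨w, hw, hle⟩ := hc a
  have hle' : ∑ i, w i * (u (a i) / u b₀) ≤ L * (u (f a) / u b₀) := by
    simp_rw [← mul_div_assoc]
    rw [← Finset.sum_div]
    exact div_le_div_of_nonneg_right hle (hu b₀).le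
  have hw0 := A.nonneg _ _ _ _ hw
  refine ⟨w, hw, hle', ?_⟩
  by_cases hfa : f a = b₀
  · beta_reduce
    rw [hfa, div_self (hu b₀).ne', one_mul]
    linarith [hN _ _ hw]
  · have hNn : 0 ≤ u (f a) / u b₀ * N := mul_nonneg (div_nonneg (hu _).le (hu _).le)
      ((totalWeight_nonneg hw0).trans (hN _ _ hw))
    set θ := u (f a) / u b₀ with hθ
    have hθ0 : 0 < θ := div_pos (hu _) (hu _)
    have hval : ∀ i, u (a i) / u b₀ = if a i = f a then θ else 1 := by
      intro i
      split_ifs with h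
      · rw [h]
      · have : a i = b₀ := by
          revert h hfa
          cases a i <;> cases f a <;> cases b₀ <;> simp
        rw [this, div_self (hu b₀).ne']
    set p := ∑ i with a i = f a, w i with hp
    set q := ∑ i with ¬ a i = f a, w i with hq
    have hq0 : 0 ≤ q := Finset.sum_nonneg fun i _ => hw0 i
    have hsum : ∑ i, w i * (u (a i) / u b₀) = p * θ + q := by
      simp_rw [hval, mul_ite, mul_one]
      rw [Finset.sum_ite, ← Finset.sum_mul]
    have htot : totalWeight w = p + q :=
      (Finset.sum_filter_add_sum_filter_not Finset.univ (fun i => a i = f a) w).symm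
    rw [hsum] at hle'
    -- From `p * θ + q ≤ L * θ` come `p ≤ L` and `q ≤ (L - p) * θ ≤ L - p`, so already `p + q ≤ L`.
    have hpL : p ≤ L := le_of_mul_le_mul_right (by linarith) hθ0
    have := mul_le_mul_of_nonneg_left hpL (sub_nonneg.2 (hle1 (f a)))
    rw [htot]
    linarith

/-- One step sends the constant vector to at most `L * 1 + N * u` and `u` to at most `L * u`. Powers
of this Jordan-type block produce the factor linear in `k`. -/
theorem IsWellBehaved.measure_iterComp_le_of_lt (h : A.IsWellBehaved) (hf : f.Nonconstant)
    (hA : ∀ x, (A.family I f x).Nonempty) {N : ℝ} (hN0 : 0 ≤ N)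
    (hN : ∀ x, ∀ w ∈ A.family I f x, totalWeight w ≤ N) {L : ℝ} (hL : A.charValue f < L) (k : ℕ) :
    A.measure (iterComp f k) ≤ L ^ (k + 1) + ((k : ℝ) + 1) * N * L ^ k := by
  obtain ⟨u, hu1, hu⟩ := exists_normalized_contracting_vector hf hA hN hL
  have hL0 : 0 < L := (A.charValue_nonneg hf hA).trans_lt hL
  have key : ∀ b, A.measureOn (iterComp f k) b ≤
      L ^ (k + 1) + u b * (((k : ℝ) + 1) * N * L ^ k) := by
    induction k with
    | zero =>
      refine measureOn_iterComp_zero_le hf fun a => ?_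
      obtain ⟨w, hw, -, hle⟩ := hu a
      exact ⟨w, hw, by simpa using hle⟩
    | succ k ih =>
      refine h.measureOn_iterComp_succ_le hf hA ih fun a => ?_
      obtain ⟨w, hw, hle, htot⟩ := hu a
      refine ⟨w, hw, ?_⟩
      have hk : 0 ≤ ((k : ℝ) + 1) * N * L ^ k := by positivity
      calc ∑ i, w i * (L ^ (k + 1) + u (a i) * (((k : ℝ) + 1) * N * L ^ k))
          = totalWeight w * L ^ (k + 1) +
              (∑ i, w i * u (a i)) * (((k : ℝ) + 1) * N * L ^ k) := by
            rw [totalWeight, Finset.sum_mul, Finset.sum_mul, ← Finset.sum_add_distrib]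
            exact Finset.sum_congr rfl fun i _ => by ring
        _ ≤ (L + u (f a) * N) * L ^ (k + 1) +
              L * u (f a) * (((k : ℝ) + 1) * N * L ^ k) := by gcongr
        _ = _ := by
            push_cast
            ring
  have hk : 0 ≤ ((k : ℝ) + 1) * N * L ^ k := by positivity
  have hb : ∀ b, A.measureOn (iterComp f k) b ≤ L ^ (k + 1) + ((k : ℝ) + 1) * N * L ^ k :=
    fun b => (key b).trans (add_le_add_right (mul_le_of_le_one_left hk (hu1 b)) _)
  exact max_le (hb _) (hb _)

theorem IsWellBehaved.measure_iterComp_le (h : A.IsWellBehaved) (hf : f.Nonconstant)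
    (hA : ∀ x, (A.family I f x).Nonempty) {N : ℝ}
    (hN : ∀ x, ∀ w ∈ A.family I f x, totalWeight w ≤ N) (k : ℕ) :
    A.measure (iterComp f k) ≤ 2 * N * ((k : ℝ) + 1) * A.charValue f ^ k := by
  have hc0 := A.charValue_nonneg hf hA
  have hcN := A.charValue_le hf hA hN
  have hN0 := hc0.trans hcN
  have hcont : Continuous fun L : ℝ => L ^ (k + 1) + ((k : ℝ) + 1) * N * L ^ k := by fun_prop
  have hlim : A.measure (iterComp f k) ≤
      A.charValue f ^ (k + 1) + ((k : ℝ) + 1) * N * A.charValue f ^ k :=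
    -- The bound is continuous in `L` and free of the vector `u`, so `L` may decrease to the
    -- characteristic value itself, even when that is 0.
    ge_of_tendsto ((hcont.tendsto (A.charValue f)).mono_left nhdsWithin_le_nhds)
      (eventually_nhdsWithin_of_forall (s := Set.Ioi (A.charValue f)) fun L hL =>
        h.measure_iterComp_le_of_lt hf hA hN0 hN hL k)
  have hpow := pow_nonneg hc0 k
  have h1 : A.charValue f ^ (k + 1) ≤ N * A.charValue f ^ k := by
    rw [pow_succ']
    exact mul_le_mul_of_nonneg_right hcN hpow
  have h2 : 0 ≤ (k : ℝ) * (N * A.charValue f ^ k) := by positivity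
  linarith

theorem IsWellBehaved.measure_iterComp_le_card (h : A.IsWellBehaved) (hf : f.Nonconstant)
    (hA : ∀ x, (A.family I f x).Nonempty) {B : ℝ} (hB : ∀ x, ∀ w ∈ A.family I f x, ∀ i, w i ≤ B)
    (k : ℕ) : A.measure (iterComp f k) ≤
      2 * B * Fintype.card I * ((k : ℝ) + 1) * A.charValue f ^ k := by
  refine (h.measure_iterComp_le hf hA (N := Fintype.card I * B) (fun x w hw => ?_) k).trans_eq
    (by ring)
  simpa [totalWeight] using Finset.sum_le_card_nsmul Finset.univ w B fun i _ => hB x w hw i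

theorem exists_totalWeight_le (A : Assemblage.{u}) (f : BoolFun I) :
    ∃ N, ∀ x, ∀ w ∈ A.family I f x, totalWeight w ≤ N := by
  have hc : Continuous (totalWeight : (I → ℝ) → ℝ) := by
    unfold totalWeight
    fun_prop
  choose N hN using fun x => ((A.compact I f x).image hc).bddAbove
  obtain ⟨M, hM⟩ := (Set.finite_range N).bddAbove
  exact ⟨M, fun x w hw => (hN x ⟨w, hw, rfl⟩).trans (hM ⟨x, rfl⟩)⟩

end Assemblage

/-! ### The composition limit -/

theorem tendsto_rpow_one_div_succ_of_pow_bounds {a : ℕ → ℝ} {c N : ℝ} (ha : ∀ k, 0 ≤ a k)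
    (hc : 0 ≤ c) (hcN : c ≤ N) (hlow : ∀ k, c ^ (k + 1) / 2 ≤ a k)
    (hup : ∀ k : ℕ, a k ≤ 2 * N * ((k : ℝ) + 1) * c ^ k) :
    Tendsto (fun k : ℕ => a k ^ (1 / ((k : ℝ) + 1))) atTop (𝓝 c) := by
  rcases hc.eq_or_lt with rfl | hc
  · refine tendsto_const_nhds.congr' ?_
    -- At `k = 0` the upper bound contains `0 ^ 0 = 1` and says nothing.
    filter_upwards [eventually_ge_atTop 1] with k hk
    have h0 : a k = 0 := by
      refine le_antisymm ?_ (ha k)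
      simpa [Nat.one_le_iff_ne_zero.1 hk] using hup k
    rw [h0, Real.zero_rpow (by positivity)]
  · have hcast : Tendsto (fun k : ℕ => (k : ℝ) + 1) atTop atTop :=
      tendsto_atTop_add_const_right _ _ tendsto_natCast_atTop_atTop
    have hinv : Tendsto (fun k : ℕ => 1 / ((k : ℝ) + 1)) atTop (𝓝 0) :=
      tendsto_one_div_add_atTop_nhds_zero_nat
    have hconst : ∀ r : ℝ, 0 < r → Tendsto (fun k : ℕ => r ^ (1 / ((k : ℝ) + 1))) atTop (𝓝 1) := by
      intro r hr
      simpa [Function.comp_def] using (Real.continuousAt_const_rpow hr.ne').tendsto.comp hinv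
    have hroot : ∀ k : ℕ, (c ^ (k + 1)) ^ (1 / ((k : ℝ) + 1)) = c := by
      intro k
      have := Real.pow_rpow_inv_natCast hc.le (Nat.succ_ne_zero k)
      simpa using this
    have hN : 0 < N := hc.trans_le hcN
    have hl : Tendsto (fun k : ℕ => c * (1 / 2 : ℝ) ^ (1 / ((k : ℝ) + 1))) atTop (𝓝 c) := by
      simpa using (hconst (1 / 2) (by norm_num)).const_mul c
    -- Writing `c ^ k` as `c ^ (k + 1) / c` isolates an exact power; the remaining factor has roots
    -- tending to 1 because `n ^ (1 / n)` does.
    have hu : Tendsto (fun k : ℕ => c * ((2 * N / c) ^ (1 / ((k : ℝ) + 1)) *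
        ((k : ℝ) + 1) ^ (1 / ((k : ℝ) + 1)))) atTop (𝓝 c) := by
      simpa using ((hconst (2 * N / c) (by positivity)).mul
        (tendsto_rpow_div.comp hcast)).const_mul c
    refine tendsto_of_tendsto_of_tendsto_of_le_of_le hl hu (fun k => ?_) fun k => ?_
    · calc c * (1 / 2 : ℝ) ^ (1 / ((k : ℝ) + 1))
          = (c ^ (k + 1) / 2) ^ (1 / ((k : ℝ) + 1)) := by
            rw [div_eq_mul_one_div (c ^ (k + 1)), Real.mul_rpow (by positivity) (by norm_num),
              hroot]
        _ ≤ a k ^ (1 / ((k : ℝ) + 1)) :=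
            Real.rpow_le_rpow (by positivity) (hlow k) (by positivity)
    · calc a k ^ (1 / ((k : ℝ) + 1))
          ≤ (c ^ (k + 1) * ((2 * N / c) * ((k : ℝ) + 1))) ^ (1 / ((k : ℝ) + 1)) := by
            refine Real.rpow_le_rpow (ha k) ((hup k).trans_eq ?_) (by positivity)
            field_simp
            ring
        _ = _ := by
            rw [Real.mul_rpow (by positivity) (by positivity),
              Real.mul_rpow (by positivity) (by positivity), hroot]

theorem Assemblage.IsWellBehaved.tendsto_measure_iterComp {A : Assemblage.{u}} {I : Type u}
    [Fintype I] {f : BoolFun I} (h : A.IsWellBehaved) (hf : f.Nonconstant)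
    (hA : ∀ x, (A.family I f x).Nonempty) :
    Tendsto (fun k : ℕ => A.measure (iterComp f k) ^ (1 / ((k : ℝ) + 1))) atTop
      (𝓝 (A.charValue f)) := by
  obtain ⟨N, hN⟩ := A.exists_totalWeight_le f
  exact tendsto_rpow_one_div_succ_of_pow_bounds (fun k => A.measure_nonneg _)
    (A.charValue_nonneg hf hA) (A.charValue_le hf hA hN) (h.charValue_pow_le hf hA)
    (h.measure_iterComp_le hf hA hN)

/-! ### The concrete measures -/

theorem composesAt_of_mem {A : Assemblage.{u}}
    (hA : A ∈ ({witnessAssemblage, fractionalWitnessAssemblage, sensitivityAssemblage} :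
      Set Assemblage.{u})) (I : Type u) [Fintype I] (J : I → Type u) [∀ i, Fintype (J i)]
    (f : BoolFun I) (g : ∀ i, BoolFun (J i)) (x : (Σ i, J i) → Bool) : A.ComposesAt f g x := by
  rcases hA with rfl | rfl | rfl
  exacts [witnessAssemblage_composesAt f g x, fractionalWitnessAssemblage_composesAt f g x,
    sensitivityAssemblage_composesAt f g x]

theorem setWeight_le_one {I : Type u} (S : Set I) (i : I) : setWeight S i ≤ 1 :=
  Set.indicator_le_self' (fun _ _ => zero_le_one) i

theorem family_nonempty_of_mem {A : Assemblage.{u}}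
    (hA : A ∈ ({witnessAssemblage, fractionalWitnessAssemblage, sensitivityAssemblage} :
      Set Assemblage.{u})) {I : Type u} [Fintype I] (f : BoolFun I) (x : I → Bool) :
    (A.family I f x).Nonempty := by
  rcases hA with rfl | rfl | rfl
  · exact ⟨_, Set.univ, fun B hB => hB.nonempty.imp fun i hi => ⟨hi, trivial⟩, rfl⟩
  · exact ⟨fun _ => 1, fun _ => ⟨zero_le_one, le_rfl⟩, fun B hB => by
      simpa using hB.nonempty.card_pos⟩
  · exact ⟨_, rfl⟩

theorem family_le_one_of_mem {A : Assemblage.{u}}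
    (hA : A ∈ ({witnessAssemblage, fractionalWitnessAssemblage, sensitivityAssemblage} :
      Set Assemblage.{u})) {I : Type u} [Fintype I] (f : BoolFun I) (x : I → Bool) :
    ∀ w ∈ A.family I f x, ∀ i, w i ≤ 1 := by
  rcases hA with rfl | rfl | rfl
  · rintro w ⟨S, -, rfl⟩
    exact setWeight_le_one S
  · exact fun w hw i => (hw.1 i).2
  · rintro w rfl
    exact setWeight_le_one _

end

theorem mainTheorem1 :
    -- the minblock assemblage is well behaved
    minBlockAssemblage.{u}.IsWellBehaved ∧
    -- the other three are well behaved, even for ensembles with constant gates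
    (∀ A ∈ ({witnessAssemblage, fractionalWitnessAssemblage, sensitivityAssemblage} :
        Set Assemblage.{u}),
      A.IsWellBehaved ∧
      ∀ (d : ℕ) (T : IndexedTree.{u} d) (f : T.Ensemble BoolFun) (x : T.Leaves → Bool),
        A.BehavesWellAt T f x) ∧
    -- the composition limit and the explicit bounds for every well-behaved assemblage
    (∀ (A : Assemblage.{u}), A.IsWellBehaved →
      ∀ (I : Type u) [Fintype I] (f : BoolFun I), f.Nonconstant →
        (∀ x, (A.family I f x).Nonempty) →
          (∀ α, IsCompatible f α →
            IsLeast (rho '' A.profileFamily f α) (A.charValueAt f α)) ∧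
          IsGreatest (A.charValueAt f '' {α | IsCompatible f α}) (A.charValue f) ∧
          Tendsto (fun k : ℕ => A.measure (iterComp f k) ^ (1 / ((k : ℝ) + 1))) atTop
            (𝓝 (A.charValue f)) ∧
          (∀ k : ℕ, A.charValue f ^ (k + 1) / 2 ≤ A.measure (iterComp f k)) ∧
          ∀ B : ℝ, (∀ x, ∀ w ∈ A.family I f x, ∀ i, w i ≤ B) →
            ∀ k : ℕ, A.measure (iterComp f k) ≤
              2 * B * Fintype.card I * ((k : ℝ) + 1) * A.charValue f ^ k) ∧
    -- in particular for certificate complexity, fractional certificate complexity and sensitivity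
    (∀ A ∈ ({witnessAssemblage, fractionalWitnessAssemblage, sensitivityAssemblage} :
        Set Assemblage.{u}),
      ∀ (I : Type u) [Fintype I] (f : BoolFun I), f.Nonconstant →
        Tendsto (fun k : ℕ => A.measure (iterComp f k) ^ (1 / ((k : ℝ) + 1))) atTop
          (𝓝 (A.charValue f)) ∧
        ∀ k : ℕ, A.charValue f ^ (k + 1) / 2 ≤ A.measure (iterComp f k) ∧
          A.measure (iterComp f k) ≤
            2 * Fintype.card I * ((k : ℝ) + 1) * A.charValue f ^ k) := by

  have hwb : ∀ A ∈ ({witnessAssemblage, fractionalWitnessAssemblage, sensitivityAssemblage} :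
      Set Assemblage.{u}), A.IsWellBehaved := fun A hA =>
    Assemblage.isWellBehaved_of_composesAt fun I _ J _ f g x _ => composesAt_of_mem hA I J f g x
  refine ⟨Assemblage.isWellBehaved_of_composesAt fun I _ J _ f g x hg =>
      minBlockAssemblage_composesAt f g x hg,
    fun A hA => ⟨hwb A hA, fun d T f x =>
      Assemblage.behavesWellAt_of_composesAt (composesAt_of_mem hA) T f x⟩,
    fun A h I _ f hf hA => ⟨fun α _ => A.isLeast_charValueAt hA α, A.isGreatest_charValue hf,
      h.tendsto_measure_iterComp hf hA, h.charValue_pow_le hf hA,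
      fun B hB k => h.measure_iterComp_le_card hf hA hB k⟩,
    fun A hA I _ f hf => ⟨(hwb A hA).tendsto_measure_iterComp hf (family_nonempty_of_mem hA f),
      fun k => ⟨(hwb A hA).charValue_pow_le hf (family_nonempty_of_mem hA f) k, ?_⟩⟩⟩
  simpa using (hwb A hA).measure_iterComp_le_card hf (family_nonempty_of_mem hA f)
    (family_le_one_of_mem hA f) k
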